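/- **Setting.** A relation on $N$ bits with finite output alphabet $\Sigma$ is a map $g\colon\{0,1\}^N\to\mathcal P(\Sigma)$; its promise is $\mathrm{Dom}(g)=\{x: g(x)\neq\emptyset\}$, and an algorithm computing $g$ must output some element of $g(x)$ on every $x\in\mathrm{Dom}(g)$. A set $S\subseteq\{0,1,*\}^n$ of partial assignments ("certificates") defines the search problem $f_S(x)=\{c\in S: c \text{ agrees with } x \text{ on all non-}* \text{ positions of } c\}$, a relation with output alphabet $S$; it is total if $f_S(x)\ne\emptyset$ for every $x\in\{0,1\}^n$. A query $\mathsf{TFNP}$ problem is a family $f=(f_{S_i})_{i\in\mathbb N}$ of total search problems on $n_i$ bits, with $n_i$ strictly increasing and $\max_{c\in S_i}|c|=O(\mathrm{polylog}\, n_i)$, where $|c|$ is the number of non-$*$ positions of $c$. The associated partial function $f_{\mathrm{fcn}}$ of $f=f_S$ has as inputs the strings $xy$ with $x\in\{0,1\}^n$ and $y\in\{0,1\}^{S}$; $f_{\mathrm{fcn}}(xy)=b$ if $y_c=b$ for all $c\in f(x)$ (for $b\in\{0,1\}$), and $xy\notin\mathrm{Dom}(f_{\mathrm{fcn}})$ if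 neither value of $b$ has this property. It is regarded as a relation with output alphabet $\{0,1\}$. For a relation $g$ on $N$ bits, $\mathrm D(g)$, $\mathrm R(g)$, $\mathrm Q(g)$ denote the deterministic, the randomized (worst-case number of queries, error $1/3$) and the quantum (error $1/3$) query complexity. $\widetilde{\deg}(g)$ is the least $d$ for which there are real polynomials $(p_s)_{s\in\Sigma}$ in $N$ variables of degree at most $d$ with $p_s(x)\ge0$ and $\sum_{s}p_s(x)\le1$ for all $x\in\{0,1\}^N$, and $\sum_{s\in g(x)}p_s(x)\ge 2/3$ for all $x\in\mathrm{Dom}(g)$. $\widetilde{\deg}^{+2}(g)$ is defined in the same way with conical juntas in place of the $p_s$, that is, non-negative linear combinations of conjunctions (products of literals $x_i$ or $1-x_i$), whose degree is the largest number of literals in a conjunction that occurs. $\mathrm{Adv}(g)$ is the infimum of $T$ such that there are weights $m_x(i)\ge0$ ($x\in\mathrm{Dom}(g)$, $i\in[N]$) with $\sum_i m_x(i)\le T$ for all $x\in\mathrm{Dom}(g)$ and $\sum_{i:x_i\ne x'_i}\sqrt{m_x(i)m_{x'}(i)}\ge1$ for all $x,x'\in\mathrm{Dom}(g)$ with $g(x)\cap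 g(x')=\emptyset$; $\mathrm{CAdv}(g)$ is the same with $\min\{m_x(i),m_{x'}(i)\}$ in place of $\sqrt{m_x(i)m_{x'}(i)}$. **Theorem.** Let $f$ be a query $\mathsf{TFNP}$ problem such that, for all sufficiently large $i$, the empty certificate $*^{n_i}$ does not belong to $S_i$ (that is, the problem cannot be solved without any query). Then, with all asymptotics along the family and with $\widetilde\Theta,\widetilde\Omega$ hiding factors polylogarithmic in the input size $n$ of $f$: 1. $\mathrm D(f_{\mathrm{fcn}})=\widetilde\Theta(\mathrm D(f))$; 2. $\mathrm R(f_{\mathrm{fcn}})=\widetilde\Theta(\mathrm R(f))$; 3. $\mathrm Q(f_{\mathrm{fcn}})=O(\mathrm Q(f))$ and $\mathrm Q(f_{\mathrm{fcn}})=\widetilde\Omega(\mathrm Q(f)^{1/3})$; 4. $\widetilde{\deg}(f_{\mathrm{fcn}})=O(\widetilde{\deg}(f))$ and $\widetilde{\deg}^{+2}(f_{\mathrm{fcn}})=O(\widetilde{\deg}^{+2}(f))$; 5. $\mathrm{CAdv}(f_{\mathrm{fcn}})=\widetilde\Omega(\mathrm{CAdv}(f))$ and $\mathrm{Adv}(f_{\mathrm{fcn}})=\widetilde\Omega(\mathrm{Adv}(f))$.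 -/

import Mathlib

open Filter Asymptotics

noncomputable section

namespace Query

/-! ### Relations, partial assignments, search problems -/

/-- A relation on bits indexed by `ι` with output alphabet `A`: to each input string it assigns
its set of allowed outputs. -/
abbrev Relation (ι A : Type) : Type := (ι → Bool) → Set A

/-- The promise of a relation: the inputs that have at least one allowed output. -/
def Relation.Dom {ι A : Type} (f : Relation ι A) : Set (ι → Bool) := {x | (f x).Nonempty}

/-- A partial assignment, an element of `{0,1,*}^ι`; here `none` plays the role of `*`. -/
abbrev PartialAssignment (ι : Type) : Type := ι → Option Bool

/-- The number of non-`*` positions of a partial assignment. -/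
def PartialAssignment.size {ι : Type} [Fintype ι] (c : PartialAssignment ι) : ℕ :=
  (Finset.univ.filter fun i => (c i).isSome).card

/-- `c ⊆ x`: the string `x` agrees with `c` on all non-`*` positions of `c`. -/
def PartialAssignment.Consistent {ι : Type} (c : PartialAssignment ι) (x : ι → Bool) : Prop :=
  ∀ i b, c i = some b → x i = b

/-- The certifying cost of a set of certificates: the largest size of a certificate in it. -/
def cert {ι : Type} [Fintype ι] (S : Finset (PartialAssignment ι)) : ℕ :=
  S.sup PartialAssignment.size

/-- The relation of the search problem given by a set `S` of certificates: on input `x`, output a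
certificate `c ∈ S` that is consistent with `x`. The output alphabet is `S` itself. -/
def searchRel {ι : Type} (S : Finset (PartialAssignment ι)) : Relation ι S :=
  fun x => {c | PartialAssignment.Consistent c.1 x}

/-- The partial function associated with the search problem `S`. Its inputs are pairs `x y`, with
`y` an array of bits indexed by `S`; the value is `b` if `y c = b` for every valid output `c` on
`x`. (If the search problem is total, there is at most one such `b` for each input.) -/
def fcn {ι : Type} (S : Finset (PartialAssignment ι)) : Relation (ι ⊕ S) Bool :=
  fun z => {b | ∀ c ∈ searchRel S (fun i => z (Sum.inl i)), z (Sum.inr c) = b}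

/-- A query `TFNP` problem: a family of total search problems on strictly increasing numbers of
bits with certificates of polylogarithmic size. -/
structure TFNP where
  /-- the number of input bits -/
  n : ℕ → ℕ
  n_strictMono : StrictMono n
  /-- the sets of certificates -/
  S : ∀ i, Finset (PartialAssignment (Fin (n i)))
  total : ∀ i x, x ∈ (searchRel (S i)).Dom
  cert_polylog : ∃ k : ℕ,
    (fun i => (cert (S i) : ℝ)) =O[atTop] fun i => Real.log (n i) ^ k

/-! ### Deterministic and randomized query complexity -/

/-- Deterministic decision trees: `node i t₀ t₁` queries bit `i` and continues with `t₀` if the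
answer is `0` and with `t₁` if the answer is `1`. -/
inductive DTree (ι A : Type) : Type
  | leaf (a : A) : DTree ι A
  | node (i : ι) (t₀ t₁ : DTree ι A) : DTree ι A

/-- The output of a decision tree on an input. -/
def DTree.eval {ι A : Type} : DTree ι A → (ι → Bool) → A
  | .leaf a, _ => a
  | .node i t₀ t₁, x => if x i then t₁.eval x else t₀.eval x

/-- The worst-case number of queries of a decision tree. -/
def DTree.depth {ι A : Type} : DTree ι A → ℕ
  | .leaf _ => 0
  | .node _ t₀ t₁ => max t₀.depth t₁.depth + 1

/-- Deterministic query complexity. -/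
def detQuery {ι A : Type} (f : Relation ι A) : ℕ :=
  sInf {d | ∃ t : DTree ι A, t.depth ≤ d ∧ ∀ x ∈ f.Dom, t.eval x ∈ f x}

/-- Randomized query complexity with error `1/3`: a randomized algorithm making at most `d` queries
is a probability distribution on decision trees of depth at most `d`. -/
def randQuery {ι A : Type} (f : Relation ι A) : ℕ :=
  sInf {d | ∃ μ : PMF (DTree ι A), (∀ t ∈ μ.support, t.depth ≤ d) ∧
    ∀ x ∈ f.Dom, 2 / 3 ≤ μ.toOuterMeasure {t | t.eval x ∈ f x}}

/-! ### Quantum query complexity -/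

/-- Basis states of a quantum query algorithm: a query register (holding an index, or `none` for
"no query"), an answer bit, and a workspace register with basis `W`. -/
abbrev QBasis (ι W : Type) : Type := Option ι × Bool × W

/-- The state space of a quantum query algorithm. -/
abbrev QState (ι W : Type) [Fintype ι] [Fintype W] : Type := EuclideanSpace ℂ (QBasis ι W)

/-- The action of the query oracle on basis states: `|i, b, w⟩ ↦ |i, b ⊕ x i, w⟩`, and
`|none, b, w⟩` is fixed. -/
def oraclePerm {ι : Type} (W : Type) (x : ι → Bool) : Equiv.Perm (QBasis ι W) :=
  Function.Involutive.toPerm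
    (fun s => (s.1, xor s.2.1 (s.1.elim false x), s.2.2))
    (by intro s; simp)

/-- The query oracle of the input `x`, as a unitary operator. -/
def oracle {ι W : Type} [Fintype ι] [Fintype W] (x : ι → Bool) :
    QState ι W ≃ₗᵢ[ℂ] QState ι W :=
  LinearIsometryEquiv.piLpCongrLeft 2 ℂ ℂ (oraclePerm W x)

/-- A quantum query algorithm: a starting basis state, the unitary operators that are applied
before the first query and after each query, and the output read off from the final measurement in
the standard basis. -/
structure QAlg (ι A W : Type) [Fintype ι] [Fintype W] where
  start : QBasis ι W
  U : ℕ → (QState ι W ≃ₗᵢ[ℂ] QState ι W)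
  out : QBasis ι W → A

open Classical in
/-- The state `U_T O_x U_{T-1} ⋯ O_x U_0 |start⟩` after `T` queries to the input `x`. -/
def QAlg.state {ι A W : Type} [Fintype ι] [Fintype W] (G : QAlg ι A W) (x : ι → Bool) :
    ℕ → QState ι W
  | 0 => G.U 0 (EuclideanSpace.single G.start 1)
  | t + 1 => G.U (t + 1) (oracle x (G.state x t))

open Classical in
/-- The probability that the output belongs to `B` if the final state is measured after `T`
queries to the input `x`. -/
def QAlg.prob {ι A W : Type} [Fintype ι] [Fintype W] (G : QAlg ι A W) (T : ℕ)
    (x : ι → Bool) (B : Set A) : ℝ :=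
  ∑ s : QBasis ι W, if G.out s ∈ B then ‖G.state x T s‖ ^ 2 else 0

/-- Bounded-error (error `1/3`) quantum query complexity. -/
def quantumQuery {ι A : Type} [Fintype ι] (f : Relation ι A) : ℕ :=
  sInf {T | ∃ (W : Type) (_ : Fintype W) (G : QAlg ι A W),
    ∀ x ∈ f.Dom, 2 / 3 ≤ G.prob T x (f x)}

/-! ### Degree measures -/

/-- A Boolean string as a point of `ℝ^ι`. -/
def toReal {ι : Type} (x : ι → Bool) : ι → ℝ := fun i => if x i then 1 else 0

open Classical in
/-- The collection of polynomials `p` computes `f` to error `ε`. The first two conditions are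
imposed on all inputs, also outside of the promise of `f`. -/
def PolyComputes {ι A : Type} [Fintype A] (f : Relation ι A) (ε : ℝ)
    (p : A → MvPolynomial ι ℝ) : Prop :=
  (∀ s x, 0 ≤ (p s).eval (toReal x)) ∧
  (∀ x, ∑ s, (p s).eval (toReal x) ≤ 1) ∧
  ∀ x ∈ f.Dom, 1 - ε ≤ ∑ s with s ∈ f x, (p s).eval (toReal x)

/-- `ε`-approximate degree of a relation. -/
def adegErr {ι A : Type} [Fintype A] (ε : ℝ) (f : Relation ι A) : ℕ :=
  sInf {d | ∃ p : A → MvPolynomial ι ℝ, (∀ s, (p s).totalDegree ≤ d) ∧ PolyComputes f ε p}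

/-- Approximate degree of a relation. -/
def adeg {ι A : Type} [Fintype A] (f : Relation ι A) : ℕ := adegErr (1 / 3) f

/-- A conical junta: a non-negative linear combination of conjunctions. The conjunction given by a
partial assignment `c` is the product of the `x i` with `c i = 1` and of the `1 - x i` with
`c i = 0`; `coeff c` is its coefficient. -/
structure ConicalJunta (ι : Type) where
  coeff : PartialAssignment ι → ℝ
  nonneg : ∀ c, 0 ≤ coeff c

open Classical in
/-- The value of a conical junta on a Boolean string: the conjunction given by `c` has value `1` on
the strings consistent with `c` and `0` on all others. -/
def ConicalJunta.eval {ι : Type} [Fintype ι] (h : ConicalJunta ι) (x : ι → Bool) : ℝ :=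
  ∑ c : PartialAssignment ι, if c.Consistent x then h.coeff c else 0

/-- A conical junta has degree at most `d` if only conjunctions of at most `d` literals occur. -/
def ConicalJunta.DegreeLE {ι : Type} [Fintype ι] (h : ConicalJunta ι) (d : ℕ) : Prop :=
  ∀ c, h.coeff c ≠ 0 → c.size ≤ d

open Classical in
/-- The collection of conical juntas `h` computes `f` to error `ε`. -/
def JuntaComputes {ι A : Type} [Fintype ι] [Fintype A] (f : Relation ι A) (ε : ℝ)
    (h : A → ConicalJunta ι) : Prop :=
  (∀ x, ∑ s, (h s).eval x ≤ 1) ∧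
  ∀ x ∈ f.Dom, 1 - ε ≤ ∑ s with s ∈ f x, (h s).eval x

/-- `ε`-approximate (two-sided) conical junta degree of a relation. -/
def appdegErr {ι A : Type} [Fintype ι] [Fintype A] (ε : ℝ) (f : Relation ι A) : ℕ :=
  sInf {d | ∃ h : A → ConicalJunta ι, (∀ s, (h s).DegreeLE d) ∧ JuntaComputes f ε h}

/-- Approximate two-sided non-negative degree (approximate conical junta degree). -/
def appdeg {ι A : Type} [Fintype ι] [Fintype A] (f : Relation ι A) : ℕ := appdegErr (1 / 3) f

/-! ### Adversary bounds -/

/-- `Δ(f)`: the pairs of inputs in the promise that have no allowed output in common. -/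
def Relation.Delta {ι A : Type} (f : Relation ι A) : Set ((ι → Bool) × (ι → Bool)) :=
  {p | p.1 ∈ f.Dom ∧ p.2 ∈ f.Dom ∧ f p.1 ∩ f p.2 = ∅}

/-- Positive-weight quantum adversary bound. -/
def adv {ι A : Type} [Fintype ι] (f : Relation ι A) : ℝ :=
  sInf {T : ℝ | ∃ m : (ι → Bool) → ι → ℝ,
    (∀ x ∈ f.Dom, ∀ i, 0 ≤ m x i) ∧
    (∀ x ∈ f.Dom, ∑ i, m x i ≤ T) ∧
    ∀ p ∈ f.Delta, 1 ≤ ∑ i with p.1 i ≠ p.2 i, Real.sqrt (m p.1 i * m p.2 i)}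

/-- Classical adversary bound. -/
def cadv {ι A : Type} [Fintype ι] (f : Relation ι A) : ℝ :=
  sInf {T : ℝ | ∃ m : (ι → Bool) → ι → ℝ,
    (∀ x ∈ f.Dom, ∀ i, 0 ≤ m x i) ∧
    (∀ x ∈ f.Dom, ∑ i, m x i ≤ T) ∧
    ∀ p ∈ f.Delta, 1 ≤ ∑ i with p.1 i ≠ p.2 i, min (m p.1 i) (m p.2 i)}

/-! ### Asymptotic notation hiding polylogarithmic factors -/

/-- `g = Õ(h)`, hiding factors polylogarithmic in `n`. -/
def SoftO (n : ℕ → ℕ) (g h : ℕ → ℝ) : Prop :=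
  ∃ k : ℕ, g =O[atTop] fun i => h i * Real.log (n i) ^ k

/-- `g = Ω̃(h)`, hiding factors polylogarithmic in `n`. -/
def SoftOmega (n : ℕ → ℕ) (g h : ℕ → ℝ) : Prop := SoftO n h g

/-- `g = Θ̃(h)`, hiding factors polylogarithmic in `n`. -/
def SoftTheta (n : ℕ → ℕ) (g h : ℕ → ℝ) : Prop := SoftO n g h ∧ SoftOmega n g h

end Query

end

/-! Upper bounds: to compute the associated function on `xy`, solve the search problem on `x`,
obtain some `c`, and read the bit `y c`; on the promise this bit is the value whichever valid `c`
was found. This costs one query, or one literal in the degree measures. The additive `1` is absorbed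
because every measure of the search problem is at least `1`: without the empty certificate,
complementary strings have no common output (`disjoint_searchRel_not`).

Lower bounds: compare, for a fixed `x`, the all-zero array with the array that is `1` exactly on the
valid outputs (`markInput`). The values are `0` and `1`, while the inputs differ only at bits `y c`
with `c` valid for `x`. So an algorithm for the function, run on `x` and zeros, has to look at such
a bit. This run needs queries to `x` only, and each `c` whose bit is looked at can be checked with
at most `cert S` queries, a polylogarithmic number.

For trees this is `DTree.search`: deterministically it always succeeds, and with randomness it fails
with probability at most `2/3`, which three runs amplify.

For quantum algorithms the hybrid argument (`one_le_mul_sum_mass`) bounds from below the total query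
weight on valid certificates along the run. Measuring the query register before a given query yields
a candidate to check. With `T` queries in the algorithm, there are `T` possible times, about `T`
repetitions for each, and about `T` queries per repetition; hence the cube. The auxiliary notion
`Prep` makes it possible to compose quantum procedures without writing down circuits.

For the adversary bounds, the weight of `y c` is moved to the positions of `c` (`moveWeight`). If
`c` is valid for `x` and `x'` has no output in common with `x`, then `c` is violated by `x'`, so the
two strings differ at a position of `c`. Both bounds are treated at once, since only superadditivity
of `min` and of the geometric mean is used (`IsMean`). -/

namespace Query

/-! ### Total search problems and their associated functions -/

section Search

variable {ι : Type} {S : Finset (PartialAssignment ι)}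

/-- The input of `fcn S` that consists of `x` and the array marking the outputs on `x` with `b`
and all other certificates with `0`. -/
noncomputable def markInput (S : Finset (PartialAssignment ι)) (x : ι → Bool) (b : Bool) :
    ι ⊕ S → Bool :=
  open Classical in Sum.elim x fun c => if c ∈ searchRel S x then b else false

@[simp] theorem markInput_inl (x : ι → Bool) (b : Bool) (i : ι) :
    markInput S x b (Sum.inl i) = x i := rfl

theorem markInput_inr_of_mem {x : ι → Bool} {c : S} (b : Bool) (h : c ∈ searchRel S x) :
    markInput S x b (Sum.inr c) = b := by
  simp [markInput, h]

theorem markInput_inr_of_notMem {x : ι → Bool} {c : S} (b : Bool) (h : c ∉ searchRel S x) :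
    markInput S x b (Sum.inr c) = false := by
  simp [markInput, h]

theorem markInput_false (x : ι → Bool) :
    markInput S x false = fun j => j.elim x fun _ => false := by
  funext j
  rcases j with i | c <;> simp [markInput]

theorem fcn_eq_singleton {z : ι ⊕ S → Bool} {b : Bool}
    (hdom : (searchRel S fun i => z (Sum.inl i)).Nonempty)
    (h : ∀ c ∈ searchRel S (fun i => z (Sum.inl i)), z (Sum.inr c) = b) : fcn S z = {b} := by
  ext b'
  obtain ⟨c, hc⟩ := hdom
  constructor
  · intro hb'
    exact (hb' c hc).symm.trans (h c hc)
  · rintro rfl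
    exact h

theorem fcn_markInput {x : ι → Bool} (hx : x ∈ (searchRel S).Dom) (b : Bool) :
    fcn S (markInput S x b) = {b} :=
  fcn_eq_singleton hx fun _ hc => markInput_inr_of_mem b hc

theorem markInput_mem_dom {x : ι → Bool} (hx : x ∈ (searchRel S).Dom) (b : Bool) :
    markInput S x b ∈ (fcn S).Dom := by
  simp [Relation.Dom, fcn_markInput hx b]

/-- A certificate consistent with both a string and its complement fixes no position. All the bounds
`1 ≤ ...` for search problems rest on this. -/
theorem disjoint_searchRel_not (hS : (fun _ => none : PartialAssignment ι) ∉ S) (x : ι → Bool) :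
    Disjoint (searchRel S x) (searchRel S fun i => !x i) := by
  rw [Set.disjoint_left]
  intro c hc hc'
  apply hS
  convert c.2 with i
  cases h : c.1 i with
  | none => rfl
  | some b =>
    have h₁ := hc i b h
    have h₂ := hc' i b h
    simp [h₁] at h₂

theorem size_le_cert [Fintype ι] {c : PartialAssignment ι} (hc : c ∈ S) : c.size ≤ cert S :=
  Finset.le_sup (f := PartialAssignment.size) hc

theorem one_le_cert [Fintype ι] (htot : ∀ x, x ∈ (searchRel S).Dom)
    (hS : (fun _ => none : PartialAssignment ι) ∉ S) : 1 ≤ cert S := by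
  obtain ⟨c, -⟩ := htot fun _ => false
  refine le_trans ?_ (size_le_cert c.2)
  rw [Nat.one_le_iff_ne_zero]
  intro h
  apply hS
  convert c.2 with i
  have h' := Finset.filter_eq_empty_iff.mp (Finset.card_eq_zero.mp h) (Finset.mem_univ i)
  exact (by simpa using h' : c.1 i = none).symm

end Search

/-! ### Decision trees -/

namespace DTree

variable {ι A B : Type}

/-- Apply a function to the output of a decision tree. -/
def map (g : A → B) : DTree ι A → DTree ι B
  | leaf a => leaf (g a)
  | node i t₀ t₁ => node i (t₀.map g) (t₁.map g)

@[simp] theorem eval_map (g : A → B) (t : DTree ι A) (x : ι → Bool) :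
    (t.map g).eval x = g (t.eval x) := by
  induction t with
  | leaf a => rfl
  | node i t₀ t₁ h₀ h₁ => simp only [map, eval, h₀, h₁]; split <;> rfl

@[simp] theorem depth_map (g : A → B) (t : DTree ι A) : (t.map g).depth = t.depth := by
  induction t with
  | leaf a => rfl
  | node i t₀ t₁ h₀ h₁ => simp only [map, depth, h₀, h₁]

/-- Query the bits in a list one after the other and then output the value of `F`. -/
def full [DecidableEq ι] (F : (ι → Bool) → A) : List ι → (ι → Bool) → DTree ι A
  | [], y => leaf (F y)
  | i :: l, y => node i (full F l (Function.update y i false)) (full F l (Function.update y i true))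

/-- The invariant of the recursion is that `y` already agrees with the input outside the list of
bits still to be queried. -/
theorem eval_full [DecidableEq ι] (F : (ι → Bool) → A) (x : ι → Bool) :
    ∀ (l : List ι) (y : ι → Bool), (∀ i ∉ l, y i = x i) → (full F l y).eval x = F x
  | [], y, h => by
    have : y = x := funext fun i => h i (by simp)
    simp [full, eval, this]
  | i :: l, y, h => by
    have key : ∀ j ∉ l, Function.update y i (x i) j = x j := by
      intro j hj
      by_cases hji : j = i
      · subst hji; simp
      · simpa [hji] using h j (by simp [hji, hj])
    have := eval_full F x l _ key
    cases hx : x i <;> simpa [full, eval, hx] using this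

theorem exists_eval_eq [Fintype ι] (F : (ι → Bool) → A) : ∃ t : DTree ι A, ∀ x, t.eval x = F x := by
  classical
  exact ⟨full F Finset.univ.toList fun _ => false, fun x => eval_full F x _ _ (by simp)⟩

/-- Check a partial assignment on a list of positions, continue with `yes` or `no`. -/
def verify (c : PartialAssignment ι) (yes no : DTree ι A) : List ι → DTree ι A
  | [] => yes
  | i :: l => node i (if c i = some true then no else verify c yes no l)
      (if c i = some false then no else verify c yes no l)

theorem eval_verify (c : PartialAssignment ι) (yes no : DTree ι A) (x : ι → Bool) (l : List ι) :
    ((∀ i ∈ l, ∀ b, c i = some b → x i = b) ∧ (verify c yes no l).eval x = yes.eval x) ∨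
    ((∃ i ∈ l, ∃ b, c i = some b ∧ x i ≠ b) ∧ (verify c yes no l).eval x = no.eval x) := by
  induction l with
  | nil => simp [verify]
  | cons i l ih =>
    by_cases h : c i = some (!x i)
    · right
      refine ⟨⟨i, by simp, _, h, by simp⟩, ?_⟩
      cases hx : x i <;> simp [verify, eval, hx, h]
    · have hev : (verify c yes no (i :: l)).eval x = (verify c yes no l).eval x := by
        cases hx : x i <;> simp [hx] at h <;> simp [verify, eval, hx, h]
      rw [hev]
      refine ih.imp (And.imp_left ?_) (And.imp_left ?_)
      · intro h' j hj b hb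
        rcases List.mem_cons.mp hj with rfl | hj
        · by_contra hne
          apply h
          rw [hb, Bool.eq_not_of_ne (Ne.symm hne)]
        · exact h' j hj b hb
      · rintro ⟨j, hj, h'⟩
        exact ⟨j, by simp [hj], h'⟩

theorem depth_verify (c : PartialAssignment ι) (yes no : DTree ι A) (l : List ι) :
    (verify c yes no l).depth ≤ l.length + max yes.depth no.depth := by
  induction l with
  | nil => simp [verify]
  | cons i l ih =>
    simp only [verify, depth, List.length_cons]
    split_ifs <;> omega

/-- Check a partial assignment, continue with `yes` or `no`. -/
noncomputable def check [Fintype ι] (c : PartialAssignment ι) (yes no : DTree ι A) : DTree ι A :=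
  verify c yes no (Finset.univ.filter fun i => (c i).isSome).toList

theorem depth_check [Fintype ι] (c : PartialAssignment ι) (yes no : DTree ι A) :
    (check c yes no).depth ≤ c.size + max yes.depth no.depth := by
  simpa [check, PartialAssignment.size] using depth_verify c yes no
    (Finset.univ.filter fun i => (c i).isSome).toList

theorem eval_check_of_consistent [Fintype ι] {c : PartialAssignment ι} {x : ι → Bool}
    (h : c.Consistent x) (yes no : DTree ι A) : (check c yes no).eval x = yes.eval x := by
  rcases eval_verify c yes no x (Finset.univ.filter fun i => (c i).isSome).toList with h' | h'
  · exact h'.2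
  · obtain ⟨⟨i, -, b, hb, hne⟩, -⟩ := h'
    exact absurd (h i b hb) hne

theorem eval_check_of_not_consistent [Fintype ι] {c : PartialAssignment ι} {x : ι → Bool}
    (h : ¬c.Consistent x) (yes no : DTree ι A) : (check c yes no).eval x = no.eval x := by
  rcases eval_verify c yes no x (Finset.univ.filter fun i => (c i).isSome).toList with h' | h'
  · refine absurd (fun i b hb => h'.1 i ?_ b hb) h
    simp [hb]
  · exact h'.2

/-- Run a second tree if the first one has no output. -/
def orElse (t' : DTree ι (Option A)) : DTree ι (Option A) → DTree ι (Option A)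
  | leaf none => t'
  | leaf (some a) => leaf (some a)
  | node i t₀ t₁ => node i (orElse t' t₀) (orElse t' t₁)

theorem eval_orElse (t' t : DTree ι (Option A)) (x : ι → Bool) :
    (orElse t' t).eval x = (t.eval x).or (t'.eval x) := by
  induction t with
  | leaf a => cases a <;> simp [orElse, eval]
  | node i t₀ t₁ h₀ h₁ => simp only [orElse, eval, h₀, h₁]; split <;> rfl

theorem depth_orElse (t' t : DTree ι (Option A)) :
    (orElse t' t).depth ≤ t.depth + t'.depth := by
  induction t with
  | leaf a => cases a <;> simp [orElse, depth]
  | node i t₀ t₁ h₀ h₁ => simp only [orElse, depth]; omega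

variable {S : Finset (PartialAssignment ι)}

/-- Turn a tree for a search problem into one for the associated function, by a final query to the
marked bit of the output. -/
def toFcn : DTree ι S → DTree (ι ⊕ S) Bool
  | leaf c => node (Sum.inr c) (leaf false) (leaf true)
  | node i t₀ t₁ => node (Sum.inl i) t₀.toFcn t₁.toFcn

theorem eval_toFcn (t : DTree ι S) (z : ι ⊕ S → Bool) :
    t.toFcn.eval z = z (Sum.inr (t.eval fun i => z (Sum.inl i))) := by
  induction t with
  | leaf c => simp [toFcn, eval]
  | node i t₀ t₁ h₀ h₁ => simp only [toFcn, eval, h₀, h₁]; split <;> rfl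

theorem depth_toFcn (t : DTree ι S) : t.toFcn.depth = t.depth + 1 := by
  induction t with
  | leaf c => simp [toFcn, depth]
  | node i t₀ t₁ h₀ h₁ => simp only [toFcn, depth, h₀, h₁]; omega

theorem eval_toFcn_mem {t : DTree ι S} {z : ι ⊕ S → Bool} (hz : z ∈ (fcn S).Dom)
    (h : (t.eval fun i => z (Sum.inl i)) ∈ searchRel S fun i => z (Sum.inl i)) :
    t.toFcn.eval z ∈ fcn S z := by
  obtain ⟨b, hb⟩ := hz
  rw [eval_toFcn, hb _ h]
  exact hb

variable [Fintype ι]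

/-- Simulate a tree for the function associated with a search problem on an array of zeros, but
check the certificate `c` if the marked bit of `c` is queried. -/
noncomputable def search : DTree (ι ⊕ S) Bool → DTree ι (Option S)
  | leaf _ => leaf none
  | node (Sum.inl i) t₀ t₁ => node i t₀.search t₁.search
  | node (Sum.inr c) t₀ _ => check c.1 (leaf (some c)) t₀.search

/-- A query to a marked bit becomes a check of at most `cert S` queries; a query to a bit of `x`
stays a single query, and `1 ≤ cert S` lets both be charged equally. -/
theorem depth_search (h : 1 ≤ cert S) (t : DTree (ι ⊕ S) Bool) :
    t.search.depth ≤ cert S * t.depth := by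
  induction t with
  | leaf b => simp [search, depth]
  | node j t₀ t₁ h₀ h₁ =>
    rcases j with i | c
    · simp only [search, depth, mul_add, mul_one]
      have h₂ := Nat.mul_le_mul_left (cert S) (le_max_left t₀.depth t₁.depth)
      have h₃ := Nat.mul_le_mul_left (cert S) (le_max_right t₀.depth t₁.depth)
      omega
    · simp only [search, depth, mul_add, mul_one]
      have h₂ := Nat.mul_le_mul_left (cert S) (le_max_left t₀.depth t₁.depth)
      have h₃ := depth_check c.1 (leaf (some c)) t₀.search
      have h₄ := size_le_cert c.2
      simp only [depth] at h₃
      omega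

/-- The search may fail but never errs, since a certificate is output only after its check. Runs can
therefore be combined without voting. -/
theorem mem_of_eval_search {t : DTree (ι ⊕ S) Bool} {x : ι → Bool} {c : S}
    (h : t.search.eval x = some c) : c ∈ searchRel S x := by
  induction t with
  | leaf b => simp [search, eval] at h
  | node j t₀ t₁ h₀ h₁ =>
    rcases j with i | c'
    · simp only [search, eval] at h
      split at h
      · exact h₁ h
      · exact h₀ h
    · simp only [search] at h
      by_cases hc : c'.1.Consistent x
      · rw [eval_check_of_consistent hc] at h
        simp only [eval, Option.some.injEq] at h
        exact h ▸ hc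
      · rw [eval_check_of_not_consistent hc] at h
        exact h₀ h

/-- If the search fails, every marked bit met on the path belongs to an invalid certificate, so it
is `0` in both inputs and the tree cannot tell them apart. -/
theorem eval_markInput_of_eval_search {t : DTree (ι ⊕ S) Bool} {x : ι → Bool}
    (h : t.search.eval x = none) : t.eval (markInput S x true) = t.eval (markInput S x false) := by
  induction t with
  | leaf b => rfl
  | node j t₀ t₁ h₀ h₁ =>
    rcases j with i | c'
    · simp only [search, eval] at h
      simp only [eval, markInput_inl]
      split at h
      · simp [*]
      · simp [*]
    · simp only [search] at h
      by_cases hc : c'.1.Consistent x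
      · rw [eval_check_of_consistent hc] at h
        simp [eval] at h
      · rw [eval_check_of_not_consistent hc] at h
        have hc' : c' ∉ searchRel S x := hc
        simp [eval, markInput_inr_of_notMem _ hc', h₀ h]

end DTree

/-! ### Deterministic query complexity -/

section Det

variable {ι : Type} [Fintype ι] {S : Finset (PartialAssignment ι)}

/-- The infimum is attained because some tree computes `f`; for an empty set `sInf` would be the
meaningless default `0`. The analogues for the other measures serve the same purpose. -/
theorem exists_detQuery {A : Type} [Nonempty A] (f : Relation ι A) :
    ∃ t : DTree ι A, t.depth ≤ detQuery f ∧ ∀ x ∈ f.Dom, t.eval x ∈ f x := by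
  classical
  refine Nat.sInf_mem (s := {d | ∃ t : DTree ι A, t.depth ≤ d ∧ ∀ x ∈ f.Dom, t.eval x ∈ f x}) ?_
  obtain ⟨t, ht⟩ := DTree.exists_eval_eq fun x : ι → Bool =>
    if h : x ∈ f.Dom then h.some else Classical.arbitrary A
  refine ⟨t.depth, t, le_rfl, fun x hx => ?_⟩
  rw [ht, dif_pos hx]
  exact hx.some_mem

theorem detQuery_fcn_le (htot : ∀ x, x ∈ (searchRel S).Dom) :
    detQuery (fcn S) ≤ detQuery (searchRel S) + 1 := by
  have : Nonempty S := ⟨(htot fun _ => false).some⟩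
  obtain ⟨t, ht, h⟩ := exists_detQuery (searchRel S)
  exact Nat.sInf_le ⟨t.toFcn, by rw [DTree.depth_toFcn]; omega,
    fun z hz => DTree.eval_toFcn_mem hz (h _ (htot _))⟩

theorem detQuery_searchRel_le (htot : ∀ x, x ∈ (searchRel S).Dom) (hcert : 1 ≤ cert S) :
    detQuery (searchRel S) ≤ cert S * detQuery (fcn S) := by
  obtain ⟨t, ht, h⟩ := exists_detQuery (fcn S)
  let c₀ : S := (htot fun _ => false).some
  refine Nat.sInf_le ⟨t.search.map fun o => o.getD c₀, ?_, fun x hx => ?_⟩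
  · rw [DTree.depth_map]
    exact (DTree.depth_search hcert t).trans (Nat.mul_le_mul_left _ ht)
  · rw [DTree.eval_map]
    cases hs : t.search.eval x with
    | some c => exact DTree.mem_of_eval_search hs
    | none =>
      -- A failed search would force the same answer on two inputs with values `true` and `false`.
      have h₁ := h _ (markInput_mem_dom hx true)
      have h₀ := h _ (markInput_mem_dom hx false)
      rw [DTree.eval_markInput_of_eval_search hs, fcn_markInput hx] at h₁
      rw [fcn_markInput hx] at h₀
      exact absurd (h₁.symm.trans h₀) (by simp)

theorem one_le_detQuery (htot : ∀ x, x ∈ (searchRel S).Dom)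
    (hS : (fun _ => none : PartialAssignment ι) ∉ S) : 1 ≤ detQuery (searchRel S) := by
  have : Nonempty S := ⟨(htot fun _ => false).some⟩
  obtain ⟨t, ht, h⟩ := exists_detQuery (searchRel S)
  rcases t with c | ⟨i, t₀, t₁⟩
  · exact absurd (h _ (htot fun i => !false))
      (Set.disjoint_left.mp (disjoint_searchRel_not hS fun _ => false) (h _ (htot fun _ => false)))
  · simp only [DTree.depth] at ht
    omega

end Det

/-! ### Randomized query complexity -/

section Rand

theorem pmf_add_compl {α : Type} (μ : PMF α) (s : Set α) :
    μ.toOuterMeasure s + μ.toOuterMeasure sᶜ = 1 := by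
  rw [PMF.toOuterMeasure_apply, PMF.toOuterMeasure_apply, ← ENNReal.tsum_add, ← μ.tsum_coe]
  congr 1
  funext a
  exact congrFun (Set.indicator_self_add_compl s μ) a

theorem pmf_compl_le {α : Type} {μ : PMF α} {s : Set α} (h : 2 / 3 ≤ μ.toOuterMeasure s) :
    μ.toOuterMeasure sᶜ ≤ 1 / 3 := by
  have h₁ := pmf_add_compl μ s
  have h₂ : (2 / 3 : ENNReal) + 1 / 3 = 1 := by
    rw [← ENNReal.add_div, show (2 : ENNReal) + 1 = 3 by norm_num]
    exact ENNReal.div_self (by norm_num) (by norm_num)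
  by_contra! hlt
  have : (2 / 3 : ENNReal) + 1 / 3 < μ.toOuterMeasure s + μ.toOuterMeasure sᶜ :=
    ENNReal.add_lt_add_of_le_of_lt (by finiteness) h hlt
  rw [h₁, h₂] at this
  exact lt_irrefl _ this

theorem pmf_le_of_compl_le {α : Type} {μ : PMF α} {s : Set α}
    (h : μ.toOuterMeasure sᶜ ≤ 1 / 3) : 2 / 3 ≤ μ.toOuterMeasure s := by
  have h₁ := pmf_add_compl μ s
  have h₂ : (2 / 3 : ENNReal) + 1 / 3 = 1 := by
    rw [← ENNReal.add_div, show (2 : ENNReal) + 1 = 3 by norm_num]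
    exact ENNReal.div_self (by norm_num) (by norm_num)
  by_contra! hlt
  have : μ.toOuterMeasure s + μ.toOuterMeasure sᶜ < 2 / 3 + 1 / 3 :=
    ENNReal.add_lt_add_of_lt_of_le (by
      exact ne_top_of_le_ne_top (by finiteness) h) hlt h
  rw [h₁, h₂] at this
  exact lt_irrefl _ this

variable {ι : Type} {S : Finset (PartialAssignment ι)}

/-- Run two randomized trees independently, the second one if the first one has no output. -/
noncomputable def pmfOrElse {A : Type} (μ ν : PMF (DTree ι (Option A))) :
    PMF (DTree ι (Option A)) :=
  μ.bind fun t => ν.map fun t' => DTree.orElse t' t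

/-- The combination fails only if both independent runs fail. -/
theorem pmfOrElse_none {A : Type} (μ ν : PMF (DTree ι (Option A))) (x : ι → Bool) :
    (pmfOrElse μ ν).toOuterMeasure {t | t.eval x = none} =
      μ.toOuterMeasure {t | t.eval x = none} * ν.toOuterMeasure {t | t.eval x = none} := by
  rw [pmfOrElse, PMF.toOuterMeasure_bind_apply, PMF.toOuterMeasure_apply μ, ← ENNReal.tsum_mul_right]
  congr 1
  funext t
  rw [PMF.toOuterMeasure_map_apply]
  by_cases h : t.eval x = none
  · simp [Set.indicator, h, DTree.eval_orElse, Set.preimage]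
  · have : (fun t' => DTree.orElse t' t) ⁻¹' {t | t.eval x = none} = ∅ := by
      ext t'
      simp [DTree.eval_orElse, h]
    simp [Set.indicator, h, this]

theorem forall_support_pmfOrElse {A : Type} {μ ν : PMF (DTree ι (Option A))}
    {P₁ P₂ P : DTree ι (Option A) → Prop} (h₁ : ∀ t ∈ μ.support, P₁ t)
    (h₂ : ∀ t ∈ ν.support, P₂ t) (h : ∀ t t', P₁ t → P₂ t' → P (DTree.orElse t' t)) :
    ∀ t ∈ (pmfOrElse μ ν).support, P t := by
  intro t ht
  simp only [pmfOrElse, PMF.mem_support_bind_iff, PMF.mem_support_map_iff] at ht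
  obtain ⟨t₁, ht₁, t₂, ht₂, rfl⟩ := ht
  exact h _ _ (h₁ _ ht₁) (h₂ _ ht₂)

variable [Fintype ι]

theorem exists_randQuery {A : Type} [Nonempty A] (f : Relation ι A) :
    ∃ μ : PMF (DTree ι A), (∀ t ∈ μ.support, t.depth ≤ randQuery f) ∧
      ∀ x ∈ f.Dom, 2 / 3 ≤ μ.toOuterMeasure {t | t.eval x ∈ f x} := by
  refine Nat.sInf_mem (s := {d | ∃ μ : PMF (DTree ι A), (∀ t ∈ μ.support, t.depth ≤ d) ∧
    ∀ x ∈ f.Dom, 2 / 3 ≤ μ.toOuterMeasure {t | t.eval x ∈ f x}}) ?_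
  obtain ⟨t, ht, h⟩ := exists_detQuery f
  refine ⟨detQuery f, PMF.pure t, by simpa using ht, fun x hx => ?_⟩
  rw [PMF.toOuterMeasure_pure_apply, if_pos (show t ∈ {t | t.eval x ∈ f x} from h x hx)]
  exact ENNReal.div_le_of_le_mul (by norm_num)

theorem randQuery_fcn_le (htot : ∀ x, x ∈ (searchRel S).Dom) :
    randQuery (fcn S) ≤ randQuery (searchRel S) + 1 := by
  have : Nonempty S := ⟨(htot fun _ => false).some⟩
  obtain ⟨μ, hμ, h⟩ := exists_randQuery (searchRel S)
  refine Nat.sInf_le ⟨μ.map DTree.toFcn, ?_, fun z hz => ?_⟩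
  · intro t ht
    rw [PMF.mem_support_map_iff] at ht
    obtain ⟨t, ht, rfl⟩ := ht
    rw [DTree.depth_toFcn]
    exact Nat.add_le_add_right (hμ t ht) 1
  · rw [PMF.toOuterMeasure_map_apply]
    exact (h _ (htot _)).trans (MeasureTheory.measure_mono fun t ht => DTree.eval_toFcn_mem hz ht)

/-- When the search fails, the tree gives equal answers on the two marked inputs and so errs on one
of them; the union bound gives `1/3 + 1/3`. -/
theorem pmf_search_none_le {x : ι → Bool} (hx : x ∈ (searchRel S).Dom)
    {μ : PMF (DTree (ι ⊕ S) Bool)}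
    (h : ∀ z ∈ (fcn S).Dom, 2 / 3 ≤ μ.toOuterMeasure {t | t.eval z ∈ fcn S z}) :
    (μ.map DTree.search).toOuterMeasure {t | t.eval x = none} ≤ 2 / 3 := by
  rw [PMF.toOuterMeasure_map_apply]
  have h₁ := pmf_compl_le (h _ (markInput_mem_dom hx true))
  have h₀ := pmf_compl_le (h _ (markInput_mem_dom hx false))
  rw [fcn_markInput hx] at h₀ h₁
  calc _ ≤ μ.toOuterMeasure ({t | t.eval (markInput S x true) ∈ ({true} : Set Bool)}ᶜ ∪
          {t | t.eval (markInput S x false) ∈ ({false} : Set Bool)}ᶜ) := by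
        refine MeasureTheory.measure_mono fun t ht => ?_
        have := DTree.eval_markInput_of_eval_search ht
        simp only [Set.mem_singleton_iff, Set.mem_union, Set.mem_compl_iff, Set.mem_ofPred_eq, this]
        cases t.eval (markInput S x false) <;> simp
    _ ≤ 1 / 3 + 1 / 3 := (MeasureTheory.measure_union_le _ _).trans (add_le_add h₁ h₀)
    _ = 2 / 3 := by rw [← ENNReal.add_div]; norm_num

/-- Three independent runs all fail with probability at most `(2/3)^3 = 8/27 ≤ 1/3`. -/
theorem randQuery_searchRel_le (htot : ∀ x, x ∈ (searchRel S).Dom) (hcert : 1 ≤ cert S) :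
    randQuery (searchRel S) ≤ 3 * (cert S * randQuery (fcn S)) := by
  obtain ⟨μ, hμ, h⟩ := exists_randQuery (fcn S)
  let c₀ : S := (htot fun _ => false).some
  set d := cert S * randQuery (fcn S)
  let ν := μ.map DTree.search
  let Sound (d : ℕ) (t : DTree ι (Option S)) : Prop :=
    t.depth ≤ d ∧ ∀ x c, t.eval x = some c → c ∈ searchRel S x
  have hν : ∀ t ∈ ν.support, Sound d t := by
    intro t ht
    rw [PMF.mem_support_map_iff] at ht
    obtain ⟨t, ht, rfl⟩ := ht
    exact ⟨(DTree.depth_search hcert t).trans (Nat.mul_le_mul_left _ (hμ t ht)),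
      fun x c => DTree.mem_of_eval_search⟩
  have combine : ∀ {d₁ d₂ : ℕ} (t t' : DTree ι (Option S)),
      Sound d₁ t → Sound d₂ t' → Sound (d₁ + d₂) (DTree.orElse t' t) := by
    intro d₁ d₂ t t' h₁ h₂
    refine ⟨(DTree.depth_orElse t' t).trans (add_le_add h₁.1 h₂.1), fun x c hc => ?_⟩
    rw [DTree.eval_orElse] at hc
    cases ht : t.eval x with
    | none => rw [ht] at hc; exact h₂.2 x c (by simpa using hc)
    | some a => rw [ht] at hc; exact h₁.2 x c (by simpa [ht] using hc)
  have hsupp : ∀ t ∈ (pmfOrElse (pmfOrElse ν ν) ν).support, Sound (d + d + d) t :=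
    forall_support_pmfOrElse (P₁ := Sound (d + d)) (P₂ := Sound d)
      (forall_support_pmfOrElse hν hν combine) hν combine
  refine Nat.sInf_le ⟨(pmfOrElse (pmfOrElse ν ν) ν).map (DTree.map fun o => o.getD c₀), ?_, ?_⟩
  · intro t ht
    rw [PMF.mem_support_map_iff] at ht
    obtain ⟨t, ht, rfl⟩ := ht
    rw [DTree.depth_map]
    have := (hsupp t ht).1
    omega
  · intro x hx
    have hnone : (pmfOrElse (pmfOrElse ν ν) ν).toOuterMeasure {t | t.eval x = none} ≤ 1 / 3 := by
      rw [pmfOrElse_none, pmfOrElse_none]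
      have := pmf_search_none_le hx h
      calc _ ≤ (2 / 3 * (2 / 3) * (2 / 3) : ENNReal) := by gcongr
        _ ≤ 1 / 3 := by
          rw [← ENNReal.toReal_le_toReal (by finiteness) (by finiteness)]
          simp
          norm_num
    refine (pmf_le_of_compl_le (μ := pmfOrElse (pmfOrElse ν ν) ν) (s := {t | t.eval x = none}ᶜ)
      (by rwa [compl_compl])).trans ?_
    rw [PMF.toOuterMeasure_map_apply]
    refine PMF.toOuterMeasure_mono _ ?_
    rintro t ⟨ht, hts⟩
    obtain ⟨c, hc⟩ := Option.ne_none_iff_exists'.mp ht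
    simpa [hc] using (hsupp t hts).2 x c hc

theorem one_le_randQuery (htot : ∀ x, x ∈ (searchRel S).Dom)
    (hS : (fun _ => none : PartialAssignment ι) ∉ S) : 1 ≤ randQuery (searchRel S) := by
  have : Nonempty S := ⟨(htot fun _ => false).some⟩
  obtain ⟨μ, hμ, h⟩ := exists_randQuery (searchRel S)
  by_contra! hlt
  have h₀ := h _ (htot fun _ => false)
  have h₁ := pmf_compl_le (h _ (htot fun _ => !false))
  have : μ.toOuterMeasure {t | t.eval (fun _ => false) ∈ searchRel S fun _ => false} ≤
      μ.toOuterMeasure {t | t.eval (fun _ => !false) ∈ searchRel S fun _ => !false}ᶜ := by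
    -- A tree of depth `0` has a fixed output, and an output valid on the zero string is invalid on
    -- its complement.
    refine PMF.toOuterMeasure_mono _ ?_
    rintro t ⟨ht, hts⟩
    have hd := hμ t hts
    rcases t with c | ⟨i, t₀, t₁⟩
    · exact Set.disjoint_left.mp (disjoint_searchRel_not hS fun _ => false) ht
    · simp only [DTree.depth] at hd
      omega
  have h₂ := (h₀.trans this).trans h₁
  rw [← ENNReal.toReal_le_toReal (by finiteness) (by finiteness)] at h₂
  simp at h₂
  norm_num at h₂

end Rand

/-! ### Isometries of state spaces -/

section Isometries

variable {V V' V'' : Type} [Fintype V] [Fintype V'] [Fintype V'']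

/-- The isometry of state spaces induced by an injective map of basis states. -/
noncomputable def embed (j : V ↪ V') : EuclideanSpace ℂ V →ₗᵢ[ℂ] EuclideanSpace ℂ V' where
  toFun ψ := WithLp.toLp 2 (Function.extend j ψ 0)
  map_add' ψ φ := by
    ext v
    by_cases h : ∃ u, j u = v
    · obtain ⟨u, rfl⟩ := h
      simp [j.injective.extend_apply]
    · simp [Function.extend_apply' _ _ _ h]
  map_smul' a ψ := by
    ext v
    by_cases h : ∃ u, j u = v
    · obtain ⟨u, rfl⟩ := h
      simp [j.injective.extend_apply]
    · simp [Function.extend_apply' _ _ _ h]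
  norm_map' ψ := by
    simp only [EuclideanSpace.norm_eq, LinearMap.coe_mk, AddHom.coe_mk]
    congr 1
    refine (Fintype.sum_of_injective j j.injective _ _ ?_ ?_).symm
    · intro v hv
      have : Function.extend j ψ 0 v = 0 := Function.extend_apply' _ _ _ hv
      simp [this]
    · intro v
      simp [j.injective.extend_apply]

@[simp] theorem embed_apply (j : V ↪ V') (ψ : EuclideanSpace ℂ V) (v : V) :
    embed j ψ (j v) = ψ v :=
  j.injective.extend_apply _ _ _

theorem embed_apply_of_notMem (j : V ↪ V') (ψ : EuclideanSpace ℂ V) {v : V'}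
    (h : v ∉ Set.range j) : embed j ψ v = 0 :=
  Function.extend_apply' _ _ _ h

theorem embed_trans (j : V ↪ V') (k : V' ↪ V'') (ψ : EuclideanSpace ℂ V) :
    embed (j.trans k) ψ = embed k (embed j ψ) := by
  ext v
  by_cases h : v ∈ Set.range k
  · obtain ⟨u, rfl⟩ := h
    rw [embed_apply]
    by_cases h' : u ∈ Set.range j
    · obtain ⟨w, rfl⟩ := h'
      rw [embed_apply]
      exact embed_apply (j.trans k) ψ w
    · rw [embed_apply_of_notMem _ _ h', embed_apply_of_notMem]
      rintro ⟨w, hw⟩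
      exact h' ⟨w, k.injective hw⟩
  · rw [embed_apply_of_notMem k _ h, embed_apply_of_notMem]
    rintro ⟨w, rfl⟩
    exact h ⟨_, rfl⟩

theorem embed_perm_apply (e : V ≃ V') (ψ : EuclideanSpace ℂ V) (v : V') :
    embed e.toEmbedding ψ v = ψ (e.symm v) := by
  obtain ⟨u, rfl⟩ := e.surjective v
  rw [e.symm_apply_apply]
  exact embed_apply e.toEmbedding ψ u

/-- Extend `b ∘ a⁻¹` from the range of `a`; in finite dimension the extension is onto. This turns
input-independent isometries into unitaries that an algorithm may apply. -/
theorem exists_unitary {E H : Type*} [NormedAddCommGroup E] [InnerProductSpace ℂ E]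
    [NormedAddCommGroup H] [InnerProductSpace ℂ H] [FiniteDimensional ℂ H] (a b : E →ₗᵢ[ℂ] H) :
    ∃ u : H ≃ₗᵢ[ℂ] H, ∀ v, u (a v) = b v := by
  let L : a.toLinearMap.range →ₗᵢ[ℂ] H := b.comp a.equivRange.symm.toLinearIsometry
  refine ⟨L.extend.toLinearIsometryEquiv rfl, fun v => ?_⟩
  have h := L.extend_apply (a.equivRange v)
  have h' : L (a.equivRange v) = b v := by simp [L]
  rw [← h', ← h]
  rfl

/-- The probability that a measurement in the standard basis yields a state satisfying `P`. -/
noncomputable def mass (ψ : EuclideanSpace ℂ V) (P : V → Prop) : ℝ :=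
  open Classical in ∑ v, if P v then ‖ψ v‖ ^ 2 else 0

theorem mass_nonneg (ψ : EuclideanSpace ℂ V) (P : V → Prop) : 0 ≤ mass ψ P :=
  Finset.sum_nonneg fun v _ => by split_ifs <;> positivity

theorem mass_mono (ψ : EuclideanSpace ℂ V) {P Q : V → Prop} (h : ∀ v, P v → Q v) :
    mass ψ P ≤ mass ψ Q := by
  refine Finset.sum_le_sum fun v _ => ?_
  by_cases hP : P v
  · simp [hP, h v hP]
  · rw [if_neg hP]
    split_ifs <;> positivity

theorem mass_add_not (ψ : EuclideanSpace ℂ V) (P : V → Prop) :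
    mass ψ P + mass ψ (fun v => ¬P v) = ‖ψ‖ ^ 2 := by
  rw [EuclideanSpace.norm_sq_eq, mass, mass, ← Finset.sum_add_distrib]
  refine Finset.sum_congr rfl fun v _ => ?_
  by_cases h : P v <;> simp [h]

theorem mass_eq_norm_sq (ψ : EuclideanSpace ℂ V) {P : V → Prop} (h : ∀ v, P v) :
    mass ψ P = ‖ψ‖ ^ 2 := by
  simp [mass, EuclideanSpace.norm_sq_eq, h]

theorem mass_le_norm_sq (ψ : EuclideanSpace ℂ V) (P : V → Prop) : mass ψ P ≤ ‖ψ‖ ^ 2 := by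
  rw [← mass_add_not ψ P]
  linarith [mass_nonneg ψ fun v => ¬P v]

theorem mass_eq_zero_iff (ψ : EuclideanSpace ℂ V) (P : V → Prop) :
    mass ψ P = 0 ↔ ∀ v, P v → ψ v = 0 := by
  rw [mass, Finset.sum_eq_zero_iff_of_nonneg fun v _ => by split_ifs <;> positivity]
  simp

theorem mass_embed (j : V ↪ V') (ψ : EuclideanSpace ℂ V) (P : V' → Prop) :
    mass (embed j ψ) P = mass ψ fun v => P (j v) := by
  refine (Fintype.sum_of_injective j j.injective _ _ ?_ ?_).symm
  · intro v hv
    simp [embed_apply_of_notMem j ψ hv]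
  · intro v
    simp

/-- The product of two states. -/
noncomputable def tens (ψ : EuclideanSpace ℂ V) (φ : EuclideanSpace ℂ V') :
    EuclideanSpace ℂ (V × V') :=
  WithLp.toLp 2 fun p => ψ p.1 * φ p.2

@[simp] theorem tens_apply {V V' : Type} (ψ : EuclideanSpace ℂ V) (φ : EuclideanSpace ℂ V')
    (p : V × V') : tens ψ φ p = ψ p.1 * φ p.2 := rfl

theorem mass_tens (ψ : EuclideanSpace ℂ V) (φ : EuclideanSpace ℂ V') (P : V → Prop)
    (Q : V' → Prop) : mass (tens ψ φ) (fun p => P p.1 ∧ Q p.2) = mass ψ P * mass φ Q := by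
  rw [mass, mass, mass, Finset.sum_mul_sum, Fintype.sum_prod_type]
  refine Finset.sum_congr rfl fun v _ => Finset.sum_congr rfl fun v' _ => ?_
  by_cases h : P v <;> by_cases h' : Q v' <;> simp [h, h', mul_pow]

theorem norm_tens (ψ : EuclideanSpace ℂ V) (φ : EuclideanSpace ℂ V') :
    ‖tens ψ φ‖ = ‖ψ‖ * ‖φ‖ := by
  have h := mass_tens ψ φ (fun _ => True) fun _ => True
  rw [mass_eq_norm_sq _ fun _ => ⟨trivial, trivial⟩, mass_eq_norm_sq _ fun _ => trivial,
    mass_eq_norm_sq _ fun _ => trivial, ← mul_pow] at h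
  exact (pow_left_inj₀ (norm_nonneg _) (by positivity) two_ne_zero).mp h

/-- Adjoining a register in a fixed state. -/
noncomputable def adjoin (V : Type) [Fintype V] (φ : EuclideanSpace ℂ V') (hφ : ‖φ‖ = 1) :
    EuclideanSpace ℂ V →ₗᵢ[ℂ] EuclideanSpace ℂ (V × V') where
  toFun ψ := tens ψ φ
  map_add' ψ ψ' := by ext p; simp [add_mul]
  map_smul' a ψ := by ext p; simp [mul_assoc]
  norm_map' ψ := by simpa [hφ] using norm_tens ψ φ

/-- Applying an isometry to the second register. -/
noncomputable def idTens (V : Type) [Fintype V]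
    (L : EuclideanSpace ℂ V' →ₗᵢ[ℂ] EuclideanSpace ℂ V'') :
    EuclideanSpace ℂ (V × V') →ₗᵢ[ℂ] EuclideanSpace ℂ (V × V'') where
  toFun ψ := WithLp.toLp 2 fun p => L (WithLp.toLp 2 fun v' => ψ (p.1, v')) p.2
  map_add' ψ φ := by
    ext p
    have : (WithLp.toLp 2 fun v' => (ψ + φ) (p.1, v') : EuclideanSpace ℂ V') =
        WithLp.toLp 2 (fun v' => ψ (p.1, v')) + WithLp.toLp 2 fun v' => φ (p.1, v') := by
      ext; simp
    change L (WithLp.toLp 2 fun v' => (ψ + φ) (p.1, v')) p.2 = _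
    rw [this, map_add]
    rfl
  map_smul' a ψ := by
    ext p
    have : (WithLp.toLp 2 fun v' => (a • ψ) (p.1, v') : EuclideanSpace ℂ V') =
        a • WithLp.toLp 2 fun v' => ψ (p.1, v') := by
      ext; simp
    change L (WithLp.toLp 2 fun v' => (a • ψ) (p.1, v')) p.2 = _
    rw [this, map_smul]
    rfl
  norm_map' ψ := by
    refine (pow_left_inj₀ (norm_nonneg _) (norm_nonneg _) two_ne_zero).mp ?_
    rw [EuclideanSpace.norm_sq_eq, EuclideanSpace.norm_sq_eq, Fintype.sum_prod_type,
      Fintype.sum_prod_type]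
    refine Finset.sum_congr rfl fun v _ => ?_
    have h : ‖L (WithLp.toLp 2 fun v' => ψ (v, v'))‖ ^ 2 =
        ‖(WithLp.toLp 2 fun v' => ψ (v, v') : EuclideanSpace ℂ V')‖ ^ 2 := by rw [L.norm_map]
    rw [EuclideanSpace.norm_sq_eq, EuclideanSpace.norm_sq_eq] at h
    exact h

theorem idTens_tens (L : EuclideanSpace ℂ V' →ₗᵢ[ℂ] EuclideanSpace ℂ V'')
    (ψ : EuclideanSpace ℂ V) (φ : EuclideanSpace ℂ V') :
    idTens V L (tens ψ φ) = tens ψ (L φ) := by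
  ext p
  have : (WithLp.toLp 2 fun v' => tens ψ φ (p.1, v') : EuclideanSpace ℂ V') = ψ p.1 • φ := by
    ext; simp
  change L (WithLp.toLp 2 fun v' => tens ψ φ (p.1, v')) p.2 = _
  rw [this]
  simp

/-- The projection onto the span of the basis states satisfying `P`. -/
noncomputable def proj (P : V → Prop) (ψ : EuclideanSpace ℂ V) : EuclideanSpace ℂ V :=
  open Classical in WithLp.toLp 2 fun v => if P v then ψ v else 0

theorem norm_proj_sq (P : V → Prop) (ψ : EuclideanSpace ℂ V) : ‖proj P ψ‖ ^ 2 = mass ψ P := by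
  rw [EuclideanSpace.norm_sq_eq, mass]
  refine Finset.sum_congr rfl fun v _ => ?_
  by_cases h : P v <;> simp [proj, h]

theorem norm_proj_le (P : V → Prop) (ψ : EuclideanSpace ℂ V) : ‖proj P ψ‖ ≤ ‖ψ‖ :=
  (pow_le_pow_iff_left₀ (norm_nonneg _) (norm_nonneg _) two_ne_zero).mp
    ((norm_proj_sq P ψ).trans_le (mass_le_norm_sq ψ P))

theorem proj_sub {V : Type} (P : V → Prop) (ψ φ : EuclideanSpace ℂ V) :
    proj P (ψ - φ) = proj P ψ - proj P φ := by
  ext v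
  by_cases h : P v <;> simp [proj, h]

end Isometries

/-! ### Families of states that can be prepared with few queries -/

section Prep

theorem oraclePerm_apply {ι : Type} (W : Type) (x : ι → Bool) (s : QBasis ι W) :
    oraclePerm W x s = (s.1, xor s.2.1 (s.1.elim false x), s.2.2) := rfl

theorem oraclePerm_symm {ι : Type} (W : Type) (x : ι → Bool) :
    (oraclePerm W x).symm = oraclePerm W x := rfl

theorem oracle_apply {ι W : Type} [Fintype ι] [Fintype W] (x : ι → Bool) (ψ : QState ι W)
    (s : QBasis ι W) : oracle x ψ s = ψ (oraclePerm W x s) := rfl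

theorem oracle_eq_embed {ι W : Type} [Fintype ι] [Fintype W] (x : ι → Bool) (ψ : QState ι W) :
    oracle x ψ = embed (oraclePerm W x).toEmbedding ψ := by
  ext s
  rw [oracle_apply, embed_perm_apply, oraclePerm_symm]

/-- `Prep ι T V ψ`: up to an isometry that does not depend on the input, the states `ψ x` can be
prepared with `T` queries to the input `x`. The query register and the answer bit are part of the
basis states `V` through the map `k`. -/
inductive Prep (ι : Type) : ℕ → ∀ (V : Type) [Fintype V],
    ((ι → Bool) → EuclideanSpace ℂ V) → Prop
  | const {V : Type} [Fintype V] (φ : EuclideanSpace ℂ V) (hφ : ‖φ‖ = 1) : Prep ι 0 V fun _ => φ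
  | isom {T : ℕ} {V V' : Type} [Fintype V] [Fintype V'] {ψ : (ι → Bool) → EuclideanSpace ℂ V}
      (L : EuclideanSpace ℂ V →ₗᵢ[ℂ] EuclideanSpace ℂ V') (h : Prep ι T V ψ) :
      Prep ι T V' fun x => L (ψ x)
  | query {T : ℕ} {V W : Type} [Fintype V] [Fintype W] {ψ : (ι → Bool) → EuclideanSpace ℂ V}
      (k : V ↪ QBasis ι W) (σ : (ι → Bool) → Equiv.Perm V)
      (hk : ∀ x v, oraclePerm W x (k v) = k (σ x v)) (h : Prep ι T V ψ) :
      Prep ι (T + 1) V fun x => embed (σ x).toEmbedding (ψ x)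

namespace Prep

variable {ι V V' : Type} [Fintype V] [Fintype V'] {T T' : ℕ}
  {ψ : (ι → Bool) → EuclideanSpace ℂ V} {φ : (ι → Bool) → EuclideanSpace ℂ V'}

theorem norm_eq_one (h : Prep ι T V ψ) (x : ι → Bool) : ‖ψ x‖ = 1 := by
  induction h with
  | const φ hφ => exact hφ
  | isom L h ih => rw [L.norm_map, ih]
  | query k σ hk h ih => rw [LinearIsometry.norm_map, ih]

/-- The second preparation is run while the first state is carried along in the workspace. -/
theorem tens (h : Prep ι T V ψ) (h' : Prep ι T' V' φ) :
    Prep ι (T + T') (V × V') fun x => tens (ψ x) (φ x) := by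
  induction h' with
  | const φ hφ => exact h.isom (adjoin V φ hφ)
  | isom L h' ih => simpa only [idTens_tens] using ih.isom (idTens V L)
  | @query T' V' W _ _ φ k σ hk h' ih =>
    let k' : V × V' ↪ QBasis ι (V × W) :=
      ⟨fun p => ((k p.2).1, (k p.2).2.1, (p.1, (k p.2).2.2)), by
        rintro ⟨v, u⟩ ⟨v', u'⟩ hp
        simp only [Prod.mk.injEq] at hp
        obtain ⟨h₁, h₂, h₃, h₄⟩ := hp
        rw [h₃, k.injective (Prod.ext h₁ (Prod.ext h₂ h₄))]⟩
    have := ih.query k' (fun x => Equiv.prodCongr (Equiv.refl V) (σ x)) (by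
      rintro x ⟨v, u⟩
      have hku := hk x u
      rw [oraclePerm_apply] at hku
      change ((k u).1, xor (k u).2.1 ((k u).1.elim false x), (v, (k u).2.2)) =
        ((k (σ x u)).1, (k (σ x u)).2.1, (v, (k (σ x u)).2.2))
      rw [← hku])
    have heq : (fun x => Query.tens (ψ x) (embed (σ x).toEmbedding (φ x))) = fun x =>
        embed (Equiv.prodCongr (Equiv.refl V) (σ x)).toEmbedding (Query.tens (ψ x) (φ x)) := by
      funext x
      ext ⟨v, u⟩
      simp [embed_perm_apply]
    rw [heq]
    exact this

/-- Each query to `j` is redirected to `r j`. The old index is kept in the workspace, since `r` need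
not be injective, and `none` simulates a bit that is constantly `0`. -/
theorem substitute {ι' : Type} [Fintype ι'] {χ : (ι' → Bool) → EuclideanSpace ℂ V}
    (h : Prep ι' T V χ) (r : ι' → Option ι) :
    Prep ι T V fun x => χ fun j => (r j).elim false x := by
  induction h with
  | const φ hφ => exact .const φ hφ
  | isom L h ih => exact ih.isom L
  | @query T V W _ _ χ k σ hk h ih =>
    let k' : V ↪ QBasis ι (Option ι' × W) :=
      ⟨fun v => ((k v).1.bind r, (k v).2.1, ((k v).1, (k v).2.2)), by
        intro v v' hv
        simp only [Prod.mk.injEq] at hv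
        exact k.injective (Prod.ext hv.2.2.1 (Prod.ext hv.2.1 hv.2.2.2))⟩
    refine ih.query k' (fun x => σ fun j => (r j).elim false x) fun x v => ?_
    set x' : ι' → Bool := fun j => (r j).elim false x
    change ((k v).1.bind r, xor (k v).2.1 (((k v).1.bind r).elim false x), ((k v).1, (k v).2.2)) =
      ((k (σ x' v)).1.bind r, (k (σ x' v)).2.1, ((k (σ x' v)).1, (k (σ x' v)).2.2))
    rw [← hk x' v, oraclePerm_apply]
    cases (k v).1 <;> rfl

/-- After the measurement of a prepared state, run a decision tree that depends on the outcome. -/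
theorem run {A : Type} (h : Prep ι T V ψ) (d : ℕ) (t : V → DTree ι A) (ht : ∀ v, (t v).depth ≤ d) :
    ∃ (V' : Type) (_ : Fintype V') (ψ' : (ι → Bool) → EuclideanSpace ℂ V') (out : V' → V × A),
      Prep ι (T + d) V' ψ' ∧ ∀ x (P : V × A → Prop),
        mass (ψ' x) (fun v => P (out v)) = mass (ψ x) fun v => P (v, (t v).eval x) := by
  induction d generalizing T V with
  | zero =>
    have hleaf : ∀ v, ∃ a, t v = .leaf a := by
      intro v
      have := ht v
      cases hv : t v with
      | leaf a => exact ⟨a, rfl⟩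
      | node i t₀ t₁ => simp [hv, DTree.depth] at this
    choose a ha using hleaf
    refine ⟨V, _, ψ, fun v => (v, a v), h, fun x P => ?_⟩
    simp [ha, DTree.eval]
  | succ d ih =>
    -- At a leaf the query is idle (`none`), which pads short branches to a common number of
    -- queries.
    let root : V → Option ι := fun v => match t v with
      | .leaf _ => none
      | .node i _ _ => some i
    let child : V × Bool → DTree ι A := fun p => match t p.1 with
      | .leaf a => .leaf a
      | .node _ t₀ t₁ => if p.2 then t₁ else t₀
    have hchild : ∀ p, (child p).depth ≤ d := by
      rintro ⟨v, b⟩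
      have := ht v
      simp only [child]
      cases hv : t v with
      | leaf a => simp [DTree.depth]
      | node i t₀ t₁ =>
        rw [hv] at this
        simp only [DTree.depth, Nat.add_le_add_iff_right, max_le_iff] at this
        cases b
        · exact this.1
        · exact this.2
    have heval : ∀ x v, (child (v, (root v).elim false x)).eval x = (t v).eval x := by
      intro x v
      simp only [child, root]
      cases hv : t v with
      | leaf a => rfl
      | node i t₀ t₁ =>
        cases hx : x i <;> simp [DTree.eval, hx]
    -- A fresh answer bit, initially `0`, receives the queried bit and selects the subtree; the old
    -- outcome `v` stays in the workspace.
    let j : V ↪ V × Bool := ⟨fun v => (v, false), fun v v' hv => (Prod.mk.inj hv).1⟩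
    let k : V × Bool ↪ QBasis ι V := ⟨fun p => (root p.1, p.2, p.1), by
      rintro ⟨v, b⟩ ⟨v', b'⟩ hp
      simp only [Prod.mk.injEq] at hp
      rw [hp.2.1, hp.2.2]⟩
    let σ : (ι → Bool) → Equiv.Perm (V × Bool) := fun x =>
      Function.Involutive.toPerm (fun p => (p.1, xor p.2 ((root p.1).elim false x)))
        (by intro p; simp)
    have h₁ := (h.isom (embed j)).query k σ fun x p => rfl
    obtain ⟨V', _, ψ', out, hψ', hout⟩ := ih h₁ child hchild
    refine ⟨V', ‹_›, ψ', fun v => ((out v).1.1, (out v).2), ?_, fun x P => ?_⟩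
    · rwa [show T + (d + 1) = T + 1 + d by ring]
    · rw [hout x fun q => P (q.1.1, q.2), ← embed_trans, mass_embed]
      have hj : ∀ v, (j.trans (σ x).toEmbedding) v = (v, (root v).elim false x) := by
        intro v
        change (v, xor false ((root v).elim false x)) = _
        rw [Bool.false_xor]
      simp only [hj, heval]

theorem state_congr {A A' W : Type} [Fintype ι] [Fintype W] (start : QBasis ι W)
    {U U' : ℕ → (QState ι W ≃ₗᵢ[ℂ] QState ι W)} (out : QBasis ι W → A) (out' : QBasis ι W → A')
    (x : ι → Bool) (h : ∀ t ≤ T, U t = U' t) :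
    (QAlg.mk start U out).state x T = (QAlg.mk start U' out').state x T := by
  induction T with
  | zero => simp [QAlg.state, h 0 le_rfl]
  | succ T ih =>
    simp only [QAlg.state, h (T + 1) le_rfl, ih fun t ht => h t (by omega)]

/-- The statement ranges over all large workspaces `W` and all isometries `j` to make the induction
work: isometry steps are absorbed into `j`, and the workspaces of different query steps are moved
into a single `W`. -/
theorem realize [Fintype ι] (h : Prep ι T V ψ) :
    ∃ N : ℕ, ∀ (W : Type) [Fintype W], N ≤ Fintype.card W →
      ∀ j : EuclideanSpace ℂ V →ₗᵢ[ℂ] QState ι W,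
      ∃ (start : QBasis ι W) (U : ℕ → (QState ι W ≃ₗᵢ[ℂ] QState ι W)),
        ∀ {A : Type} (out : QBasis ι W → A) x, (QAlg.mk start U out).state x T = j (ψ x) := by
  classical
  induction h with
  | const φ hφ =>
    refine ⟨1, fun W _ hW j => ?_⟩
    obtain ⟨w⟩ := Fintype.card_pos_iff.mp hW
    let start : QBasis ι W := (none, false, w)
    obtain ⟨u, hu⟩ := exists_unitary
      (LinearIsometry.toSpanSingleton ℂ (QState ι W) (v := EuclideanSpace.single start 1) (by simp))
      (LinearIsometry.toSpanSingleton ℂ (QState ι W) (v := j φ) (by rw [j.norm_map, hφ]))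
    refine ⟨start, fun _ => u, fun out x => ?_⟩
    have := hu 1
    simp only [LinearIsometry.toSpanSingleton_apply, one_smul] at this
    simp only [QAlg.state]
    convert this
  | isom L h ih =>
    obtain ⟨N, hN⟩ := ih
    exact ⟨N, fun W _ hW j => hN W hW (j.comp L)⟩
  | @query T V W₀ _ _ ψ k σ hk h ih =>
    obtain ⟨N, hN⟩ := ih
    refine ⟨max N (Fintype.card W₀), fun W _ hW j => ?_⟩
    obtain ⟨e⟩ := Function.Embedding.nonempty_of_card_le ((le_max_right _ _).trans hW)
    let e' : QBasis ι W₀ ↪ QBasis ι W := (Function.Embedding.refl _).prodMap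
      ((Function.Embedding.refl _).prodMap e)
    -- The earlier states are laid out on the query registers by `k`, so that the oracle acts on
    -- them as `σ`; afterwards `u` carries them to their place under `j`.
    obtain ⟨start, U, hU⟩ := hN W ((le_max_left _ _).trans hW) (embed (k.trans e'))
    obtain ⟨u, hu⟩ := exists_unitary (embed (k.trans e')) j
    refine ⟨start, Function.update U (T + 1) u, fun out x => ?_⟩
    have hstate := state_congr (T := T) (U := Function.update U (T + 1) u) (U' := U) start out out x
      fun t ht => Function.update_of_ne (by omega) _ _
    simp only [QAlg.state, Function.update_self]
    rw [hstate, hU, oracle_eq_embed, ← hu, ← embed_trans, ← embed_trans]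
    congr 3
    ext v : 1
    have := hk x v
    rw [oraclePerm_apply] at this
    simp [e', oraclePerm_apply, ← this]

theorem exists_qAlg {A : Type} [Nonempty A] [Fintype ι] (h : Prep ι T V ψ) (out : V → A) :
    ∃ (W : Type) (_ : Fintype W) (G : QAlg ι A W), ∀ x B,
      G.prob T x B = mass (ψ x) fun v => out v ∈ B := by
  obtain ⟨N, hN⟩ := h.realize
  let j : V ↪ QBasis ι (V ⊕ Fin N) := ⟨fun v => (none, false, Sum.inl v), by
    intro v v' hv
    simpa using hv⟩
  obtain ⟨start, U, hU⟩ := hN (V ⊕ Fin N) (by simp) (embed j)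
  -- Basis states outside the range of `j` have amplitude zero, so their output is irrelevant.
  refine ⟨_, _, ⟨start, U, Function.extend j out fun _ => Classical.arbitrary A⟩, fun x B => ?_⟩
  change mass (QAlg.state _ x T) _ = _
  rw [hU, mass_embed]
  simp [j.injective.extend_apply]

theorem quantumQuery_le {A : Type} [Nonempty A] [Fintype ι] {f : Relation ι A}
    (h : Prep ι T V ψ) (out : V → A)
    (hout : ∀ x ∈ f.Dom, 2 / 3 ≤ mass (ψ x) fun v => out v ∈ f x) : quantumQuery f ≤ T := by
  obtain ⟨W, _, G, hG⟩ := h.exists_qAlg out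
  exact Nat.sInf_le ⟨W, _, G, fun x hx => (hout x hx).trans_eq (hG x _).symm⟩

theorem state {A W : Type} [Fintype ι] [Fintype W] (G : QAlg ι A W) (t : ℕ) :
    Prep ι t (QBasis ι W) fun x => G.state x t := by
  classical
  induction t with
  | zero =>
    refine .const _ ?_
    simp
  | succ t ih =>
    have := (ih.query (Function.Embedding.refl _) (oraclePerm W) fun x v => rfl).isom
      (G.U (t + 1)).toLinearIsometry
    simp only [← oracle_eq_embed] at this
    exact this

theorem unit (ι : Type) : ∃ ψ : (ι → Bool) → EuclideanSpace ℂ Unit, Prep ι 0 Unit ψ :=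
  ⟨_, .const (EuclideanSpace.single () 1) (by simp)⟩

end Prep

theorem prob_eq_mass {ι A W : Type} [Fintype ι] [Fintype W] (G : QAlg ι A W) (T : ℕ)
    (x : ι → Bool) (B : Set A) : G.prob T x B = mass (G.state x T) fun s => G.out s ∈ B := rfl

theorem exists_quantumQuery {ι A : Type} [Fintype ι] [Nonempty A] (f : Relation ι A) :
    ∃ (W : Type) (_ : Fintype W) (G : QAlg ι A W),
      ∀ x ∈ f.Dom, 2 / 3 ≤ G.prob (quantumQuery f) x (f x) := by
  refine Nat.sInf_mem (s := {T | ∃ (W : Type) (_ : Fintype W) (G : QAlg ι A W),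
    ∀ x ∈ f.Dom, 2 / 3 ≤ G.prob T x (f x)}) ?_
  obtain ⟨t, ht, h⟩ := exists_detQuery f
  obtain ⟨ψ, hψ⟩ := Prep.unit ι
  obtain ⟨V, _, ψ', out, hψ', hout⟩ := hψ.run _ (fun _ => t) fun _ => ht
  obtain ⟨W, _, G, hG⟩ := hψ'.exists_qAlg fun v => (out v).2
  refine ⟨0 + detQuery f, W, inferInstance, G, fun x hx => ?_⟩
  rw [hG, hout x fun p => p.2 ∈ f x]
  rw [mass_eq_norm_sq _ fun _ => h x hx, hψ.norm_eq_one]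
  norm_num

end Prep

/-! ### Quantum query complexity -/

section Quantum

variable {ι : Type} {S : Finset (PartialAssignment ι)}

/-- With at most `T` queries one can find an output of the search problem `S` that is known to be
valid, except for a failure probability of at most `p x` on the input `x`. -/
def Searches (S : Finset (PartialAssignment ι)) (T : ℕ) (p : (ι → Bool) → ℝ) : Prop :=
  ∃ T' ≤ T, ∃ (V : Type) (_ : Fintype V) (ψ : (ι → Bool) → EuclideanSpace ℂ V)
    (out : V → Option S), Prep ι T' V ψ ∧
      ∀ x, mass (ψ x) (fun v => out v = none) ≤ p x ∧
        ∀ v c, ψ x v ≠ 0 → out v = some c → c ∈ searchRel S x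

theorem Searches.one (S : Finset (PartialAssignment ι)) : Searches S 0 1 := by
  obtain ⟨ψ, hψ⟩ := Prep.unit ι
  refine ⟨0, le_rfl, Unit, inferInstance, ψ, fun _ => none, hψ, fun x => ⟨?_, by simp⟩⟩
  refine (mass_le_norm_sq _ _).trans ?_
  simp [hψ.norm_eq_one x]

/-- A found output is known to be valid, so one success in two independent runs is enough and the
failure probabilities multiply. -/
theorem Searches.mul {T T' : ℕ} {p p' : (ι → Bool) → ℝ} (h : Searches S T p)
    (h' : Searches S T' p') : Searches S (T + T') (p * p') := by
  obtain ⟨T₁, hT, V, _, ψ, out, hψ, hout⟩ := h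
  obtain ⟨T₁', hT', V', _, ψ', out', hψ', hout'⟩ := h'
  refine ⟨T₁ + T₁', add_le_add hT hT', V × V', inferInstance, fun x => tens (ψ x) (ψ' x),
    fun v => (out v.1).or (out' v.2), hψ.tens hψ', fun x => ⟨?_, ?_⟩⟩
  · simp only [Option.or_eq_none_iff]
    rw [mass_tens (ψ x) (ψ' x) (fun v => out v = none) fun v => out' v = none]
    exact mul_le_mul (hout x).1 (hout' x).1 (mass_nonneg _ _)
      ((mass_nonneg _ _).trans (hout x).1)
  · rintro ⟨v, v'⟩ c hv hc
    rw [tens_apply] at hv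
    rcases Option.or_eq_some_iff.mp hc with h | h
    · exact (hout x).2 v c (left_ne_zero_of_mul hv) h
    · exact (hout' x).2 v' c (right_ne_zero_of_mul hv) h.2

theorem Searches.pow {T : ℕ} {p : (ι → Bool) → ℝ} (h : Searches S T p) (m : ℕ) :
    Searches S (m * T) (p ^ m) := by
  induction m with
  | zero => simpa using Searches.one S
  | succ m ih => simpa only [add_mul, one_mul, pow_succ] using ih.mul h

theorem Searches.prod {T : ℕ} {p : ℕ → (ι → Bool) → ℝ} {n : ℕ}
    (h : ∀ t < n, Searches S T (p t)) : Searches S (n * T) (∏ t ∈ Finset.range n, p t) := by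
  induction n with
  | zero => simpa using Searches.one S
  | succ n ih =>
    rw [Finset.prod_range_succ, add_mul, one_mul]
    exact (ih fun t ht => h t (by omega)).mul (h n (by omega))

theorem Searches.mono {T T' : ℕ} {p p' : (ι → Bool) → ℝ} (h : Searches S T p) (hT : T ≤ T')
    (hp : p ≤ p') : Searches S T' p' := by
  obtain ⟨T₁, hT₁, V, _, ψ, out, hψ, hout⟩ := h
  exact ⟨T₁, hT₁.trans hT, V, _, ψ, out, hψ, fun x => ⟨(hout x).1.trans (hp x), (hout x).2⟩⟩

variable [Fintype ι]

theorem quantumQuery_fcn_le (htot : ∀ x, x ∈ (searchRel S).Dom) :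
    quantumQuery (fcn S) ≤ quantumQuery (searchRel S) + 1 := by
  have : Nonempty S := ⟨(htot fun _ => false).some⟩
  obtain ⟨W, _, G, hG⟩ := exists_quantumQuery (searchRel S)
  have h : Prep (ι ⊕ S) (quantumQuery (searchRel S)) (QBasis ι W) fun z =>
      G.state (fun i => z (Sum.inl i)) (quantumQuery (searchRel S)) :=
    (Prep.state G _).substitute fun i => some (Sum.inl i)
  -- After measuring the output `c`, one more query reads the bit `y c`.
  obtain ⟨V, _, ψ, out, hψ, hout⟩ := h.run 1
    (fun s => .node (Sum.inr (G.out s)) (.leaf false) (.leaf true)) fun s => le_rfl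
  refine hψ.quantumQuery_le (fun v => (out v).2) fun z hz => ?_
  rw [hout z fun p => p.2 ∈ fcn S z]
  refine (hG _ (htot fun i => z (Sum.inl i))).trans ?_
  rw [prob_eq_mass]
  refine mass_mono _ fun s hs => ?_
  obtain ⟨b, hb⟩ := hz
  have := hb _ hs
  simp only [DTree.eval, this]
  cases b <;> exact hb

theorem one_le_quantumQuery (htot : ∀ x, x ∈ (searchRel S).Dom)
    (hS : (fun _ => none : PartialAssignment ι) ∉ S) : 1 ≤ quantumQuery (searchRel S) := by
  have : Nonempty S := ⟨(htot fun _ => false).some⟩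
  obtain ⟨W, _, G, hG⟩ := exists_quantumQuery (searchRel S)
  by_contra! hlt
  rw [Nat.lt_one_iff.mp hlt] at hG
  have h₀ := hG _ (htot fun _ => false)
  have h₁ := hG _ (htot fun _ => !false)
  rw [prob_eq_mass] at h₀ h₁
  have h₂ : mass (G.state (fun _ => false) 0) (fun s => G.out s ∈ searchRel S fun _ => !false) ≤
      mass (G.state (fun _ => false) 0) fun s => ¬G.out s ∈ searchRel S fun _ => false :=
    mass_mono _ fun s hs hs' =>
      Set.disjoint_left.mp (disjoint_searchRel_not hS fun _ => false) hs' hs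
  have h₃ := mass_add_not (G.state (fun _ => false) 0)
    fun s => G.out s ∈ searchRel S fun _ => false
  rw [(Prep.state G 0).norm_eq_one] at h₃
  -- Before any query the state does not depend on the input.
  have h₄ : G.state (fun _ => !false) 0 = G.state (fun _ => false) 0 := rfl
  rw [h₄] at h₁
  linarith

/-- Measuring a prepared state yields a candidate, which can then be checked. -/
theorem Prep.searches {T : ℕ} {V : Type} [Fintype V] {ψ : (ι → Bool) → EuclideanSpace ℂ V}
    (h : Prep ι T V ψ) (cand : V → Option S) :
    Searches S (T + cert S)
      fun x => 1 - mass (ψ x) fun v => ∃ c ∈ searchRel S x, cand v = some c := by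
  let t : V → DTree ι (Option S) := fun v => match cand v with
    | none => .leaf none
    | some c => .check c.1 (.leaf (some c)) (.leaf none)
  have ht : ∀ v, (t v).depth ≤ cert S := by
    intro v
    simp only [t]
    cases cand v with
    | none => simp [DTree.depth]
    | some c =>
      have := DTree.depth_check c.1 (.leaf (some c)) (.leaf none : DTree ι (Option S))
      simp only [DTree.depth, max_self, add_zero] at this
      exact this.trans (size_le_cert c.2)
  have heval : ∀ x v c, (t v).eval x = some c ↔ c ∈ searchRel S x ∧ cand v = some c := by
    intro x v c
    simp only [t]
    cases cand v with
    | none => simp [DTree.eval]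
    | some c' =>
      by_cases hc : c'.1.Consistent x
      · have hc' : c' ∈ searchRel S x := hc
        simp only [DTree.eval_check_of_consistent hc, DTree.eval, Option.some.injEq]
        constructor
        · rintro rfl
          exact ⟨hc', rfl⟩
        · exact And.right
      · have hc' : c' ∉ searchRel S x := hc
        simp only [DTree.eval_check_of_not_consistent hc, DTree.eval, Option.some.injEq]
        simp only [reduceCtorEq, false_iff, not_and]
        rintro hc₁ rfl
        exact hc' hc₁
  obtain ⟨V', _, ψ', out, hψ', hout⟩ := h.run _ t ht
  refine ⟨_, le_rfl, V', ‹_›, ψ', fun v => (out v).2, hψ', fun x => ⟨?_, ?_⟩⟩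
  · rw [hout x fun p => p.2 = none]
    have h₁ := mass_add_not (ψ x) fun v => ∃ c ∈ searchRel S x, cand v = some c
    rw [h.norm_eq_one, one_pow] at h₁
    have h₂ : mass (ψ x) (fun v => (t v).eval x = none) ≤
        mass (ψ x) fun v => ¬∃ c ∈ searchRel S x, cand v = some c := by
      refine mass_mono _ ?_
      rintro v hv ⟨c, hc⟩
      rw [(heval x v c).mpr hc] at hv
      simp at hv
    linarith
  · intro v c hv hc
    by_contra hne
    have h₁ := hout x fun p => ∃ c, p.2 = some c ∧ c ∉ searchRel S x
    have h₂ : mass (ψ x) (fun v => ∃ c, (t v).eval x = some c ∧ c ∉ searchRel S x) = 0 := by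
      rw [mass_eq_zero_iff]
      rintro v ⟨c, hc, hc'⟩
      exact absurd ((heval x v c).mp hc).1 hc'
    rw [h₂, mass_eq_zero_iff] at h₁
    exact hv (h₁ v ⟨c, hc, hne⟩)

theorem Searches.quantumQuery_le {T : ℕ} {p : (ι → Bool) → ℝ}
    (htot : ∀ x, x ∈ (searchRel S).Dom) (h : Searches S T p) (hp : ∀ x, p x ≤ 1 / 3) :
    quantumQuery (searchRel S) ≤ T := by
  let c₀ : S := (htot fun _ => false).some
  have : Nonempty S := ⟨c₀⟩
  obtain ⟨T₁, hT, V, _, ψ, out, hψ, hout⟩ := h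
  refine (hψ.quantumQuery_le (fun v => (out v).getD c₀) fun x _ => ?_).trans hT
  have h₁ := mass_add_not (ψ x) fun v => (out v).getD c₀ ∈ searchRel S x
  have h₂ : mass (ψ x) (fun v => ¬(out v).getD c₀ ∈ searchRel S x) ≤
      mass (ψ x) fun v => out v = none := by
    refine Finset.sum_le_sum fun v _ => ?_
    by_cases hv : ψ x v = 0
    · simp [hv]
    · cases ho : out v with
      | none =>
        split_ifs <;> simp
      | some c =>
        have hm : (out v).getD c₀ ∈ searchRel S x := by
          rw [ho]
          exact (hout x).2 v c hv ho
        rw [if_neg (not_not.mpr hm)]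
        split_ifs <;> positivity
  rw [hψ.norm_eq_one, one_pow] at h₁
  linarith [(hout x).1, hp x]

/-! The hybrid argument. -/

/-- The oracles agree on basis states that query no differing position. On the remaining component
each preserves the norm, and the triangle inequality gives the factor `2`. -/
theorem norm_oracle_sub_oracle_le {ι W : Type} [Fintype ι] [Fintype W] (z z' : ι → Bool)
    (ψ : QState ι W) :
    ‖oracle z ψ - oracle z' ψ‖ ≤
      2 * Real.sqrt (mass ψ fun s => ∃ i, s.1 = some i ∧ z i ≠ z' i) := by
  set P : QBasis ι W → Prop := fun s => ∃ i, s.1 = some i ∧ z i ≠ z' i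
  have h : oracle z ψ - oracle z' ψ = oracle z (proj P ψ) - oracle z' (proj P ψ) := by
    ext s
    simp only [PiLp.sub_apply, oracle_apply]
    by_cases hs : P s
    · have h₁ : P (oraclePerm W z s) := hs
      have h₂ : P (oraclePerm W z' s) := hs
      simp [proj, h₁, h₂]
    · have h₁ : oraclePerm W z s = oraclePerm W z' s := by
        rcases s with ⟨i, b, w⟩
        simp only [oraclePerm_apply]
        cases i with
        | none => rfl
        | some i =>
          have : z i = z' i := by
            by_contra hne
            exact hs ⟨i, rfl, hne⟩
          simp [this]
      rw [h₁]
      simp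
  have h' : Real.sqrt (mass ψ P) = ‖proj P ψ‖ := by
    rw [← norm_proj_sq, Real.sqrt_sq (norm_nonneg _)]
  rw [h, h']
  refine (norm_sub_le _ _).trans ?_
  simp only [LinearIsometryEquiv.norm_map]
  linarith

/-- Exchanging the oracle costs an error at each query, and later unitaries do not amplify it. All
query weights are measured along the run on `z`. -/
theorem norm_state_sub_state_le {ι A W : Type} [Fintype ι] [Fintype W] (G : QAlg ι A W)
    (z z' : ι → Bool) (T : ℕ) :
    ‖G.state z T - G.state z' T‖ ≤ 2 * ∑ t ∈ Finset.range T,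
      Real.sqrt (mass (G.state z t) fun s => ∃ i, s.1 = some i ∧ z i ≠ z' i) := by
  induction T with
  | zero => simp [QAlg.state]
  | succ T ih =>
    rw [Finset.sum_range_succ, mul_add]
    simp only [QAlg.state]
    rw [← map_sub, LinearIsometryEquiv.norm_map]
    have h₁ : oracle z (G.state z T) - oracle z' (G.state z' T) =
        oracle z' (G.state z T - G.state z' T) +
          (oracle z (G.state z T) - oracle z' (G.state z T)) := by
      rw [map_sub]
      abel
    rw [h₁]
    refine (norm_add_le _ _).trans (add_le_add ?_ (norm_oracle_sub_oracle_le _ _ _))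
    rwa [LinearIsometryEquiv.norm_map]

theorem one_div_le_norm_sub {V : Type} [Fintype V] {ψ φ : EuclideanSpace ℂ V} {P : V → Prop}
    (hψ : 2 / 3 ≤ mass ψ P) (hφ : mass φ P ≤ 1 / 3) : 1 / 5 ≤ ‖ψ - φ‖ := by
  have h₁ := norm_proj_le P (ψ - φ)
  have h₂ := norm_sub_norm_le (proj P ψ) (proj P φ)
  rw [← proj_sub] at h₂
  rw [← norm_proj_sq] at hψ hφ
  -- `0.8² < 2/3` and `0.6² > 1/3`, which leaves the gap `1/5`.
  have h₃ : 8 / 10 ≤ ‖proj P ψ‖ := by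
    by_contra! h
    nlinarith [norm_nonneg (proj P ψ)]
  have h₄ : ‖proj P φ‖ ≤ 6 / 10 := by
    by_contra! h
    nlinarith [norm_nonneg (proj P φ)]
  linarith

/-- An algorithm for the function associated with a search problem has to query, on an array of
zeros, the marked bits of the outputs of the search problem. -/
theorem one_le_mul_sum_mass {W : Type} [Fintype W] (G : QAlg (ι ⊕ S) Bool W) {T : ℕ}
    (hG : ∀ z ∈ (fcn S).Dom, 2 / 3 ≤ G.prob T z (fcn S z)) {x : ι → Bool}
    (hx : x ∈ (searchRel S).Dom) :
    1 / 100 ≤ T * ∑ t ∈ Finset.range T, mass (G.state (markInput S x false) t)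
      fun s => ∃ c ∈ searchRel S x, s.1 = some (Sum.inr c) := by
  set z := markInput S x false
  set z' := markInput S x true
  set w : ℕ → ℝ := fun t => mass (G.state z t) fun s => ∃ c ∈ searchRel S x, s.1 = some (Sum.inr c)
  have h₀ := hG _ (markInput_mem_dom hx false)
  have h₁ := hG _ (markInput_mem_dom hx true)
  rw [fcn_markInput hx, prob_eq_mass] at h₀ h₁
  have h₂ : mass (G.state z' T) (fun s => G.out s ∈ ({false} : Set Bool)) ≤ 1 / 3 := by
    have h := mass_add_not (G.state z' T) fun s => G.out s ∈ ({false} : Set Bool)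
    have h' : mass (G.state z' T) (fun s => G.out s ∈ ({true} : Set Bool)) ≤
        mass (G.state z' T) fun s => ¬G.out s ∈ ({false} : Set Bool) :=
      mass_mono _ fun s hs => by
        rw [Set.mem_singleton_iff] at hs
        simp [hs]
    rw [(Prep.state G T).norm_eq_one] at h
    linarith
  have h₃ := (one_div_le_norm_sub h₀ h₂).trans (norm_state_sub_state_le G z z' T)
  have h₄ : ∀ t, mass (G.state z t) (fun s => ∃ j, s.1 = some j ∧ z j ≠ z' j) ≤ w t := by
    intro t
    refine mass_mono _ ?_
    rintro s ⟨i | c, hs, hne⟩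
    · exact absurd rfl hne
    · refine ⟨c, ?_, hs⟩
      by_contra hc
      exact hne ((markInput_inr_of_notMem _ hc).trans (markInput_inr_of_notMem _ hc).symm)
  have h₅ : 1 / 10 ≤ ∑ t ∈ Finset.range T, Real.sqrt (w t) := by
    have := Finset.sum_le_sum fun t (_ : t ∈ Finset.range T) => Real.sqrt_le_sqrt (h₄ t)
    linarith
  -- Cauchy–Schwarz; with `h₅` it yields the constant `1/100 = (1/10)^2`.
  have h₆ : (∑ t ∈ Finset.range T, Real.sqrt (w t)) ^ 2 ≤ T * ∑ t ∈ Finset.range T, w t := by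
    have := sq_sum_le_card_mul_sum_sq (s := Finset.range T) (f := fun t => Real.sqrt (w t))
    simpa only [Real.sq_sqrt (mass_nonneg _ _), Finset.card_range, w] using this
  nlinarith

/-- Since it is unknown at which time `t` the query weight `w t` is large, every `t < T` is tried
`200 * T` times. The search for `t` fails with probability at most `exp (-200 T w_t)`, and the
product over `t` is at most `exp (-2) ≤ 1/3`. -/
theorem quantumQuery_searchRel_le (htot : ∀ x, x ∈ (searchRel S).Dom) (hcert : 1 ≤ cert S) :
    quantumQuery (searchRel S) ≤ 400 * quantumQuery (fcn S) ^ 3 * cert S := by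
  obtain ⟨W, _, G, hG⟩ := exists_quantumQuery (fcn S)
  set T := quantumQuery (fcn S)
  let cand : QBasis (ι ⊕ S) W → Option S := fun s => s.1.bind fun j => j.elim (fun _ => none) some
  have hcand : ∀ s c, cand s = some c ↔ s.1 = some (Sum.inr c) := by
    rintro ⟨_ | i | c', b, w⟩ c <;> simp [cand]
  let w : ℕ → (ι → Bool) → ℝ := fun t x => mass (G.state (markInput S x false) t)
    fun s => ∃ c ∈ searchRel S x, s.1 = some (Sum.inr c)
  have hsearch : ∀ t < T, Searches S (200 * T * (T + cert S))
      (fun x => Real.exp (-(200 * T * w t x))) := by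
    intro t ht
    -- Marked bits are replaced by zeros, so the run on the all-zero array uses queries to `x` only.
    have h := (Prep.state G t).substitute fun j => j.elim some fun _ => none
    have hz : ∀ x : ι → Bool, (fun j : ι ⊕ S => (j.elim some fun _ => none : Option ι).elim false x) =
        markInput S x false := by
      intro x
      rw [markInput_false]
      funext j
      rcases j with i | c <;> rfl
    simp only [hz] at h
    refine ((h.searches cand).pow (200 * T)).mono (Nat.mul_le_mul_left _ (by omega)) fun x => ?_
    simp only [hcand, Pi.pow_apply]
    have hle : w t x ≤ 1 := by
      refine (mass_le_norm_sq _ _).trans ?_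
      rw [(Prep.state G t).norm_eq_one, one_pow]
    calc (1 - w t x) ^ (200 * T) ≤ Real.exp (-w t x) ^ (200 * T) :=
          pow_le_pow_left₀ (by linarith) (Real.one_sub_le_exp_neg _) _
      _ = Real.exp (-(200 * T * w t x)) := by
          rw [← Real.exp_nat_mul]
          push_cast
          ring_nf
  refine ((Searches.prod hsearch).quantumQuery_le htot fun x => ?_).trans ?_
  · rw [Finset.prod_apply, ← Real.exp_sum, Finset.sum_neg_distrib, ← Finset.mul_sum]
    have h := one_le_mul_sum_mass G hG (htot x)
    have h₂ : (2 : ℝ) ≤ 200 * T * ∑ t ∈ Finset.range T, w t x := by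
      simp only [w]
      linarith
    have h₃ : Real.exp (-(200 * T * ∑ t ∈ Finset.range T, w t x)) ≤ Real.exp (-2) :=
      Real.exp_le_exp.mpr (by linarith)
    refine h₃.trans ?_
    rw [Real.exp_neg, one_div]
    refine inv_anti₀ (by norm_num) ?_
    linarith [Real.add_one_le_exp (2 : ℝ)]
  · rcases Nat.eq_zero_or_pos T with h | h
    · simp [h]
    · have h₁ : T + cert S ≤ 2 * (T * cert S) := by nlinarith
      calc T * (200 * T * (T + cert S)) ≤ T * (200 * T * (2 * (T * cert S))) := by gcongr
        _ = 400 * T ^ 3 * cert S := by ring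

end Quantum

/-! ### Degree measures -/

section Degree

variable {ι : Type} {S : Finset (PartialAssignment ι)}

-- Complementary strings would need weight `2/3` each on disjoint sets of outputs, out of a total of
-- at most `1`.
open Classical in
theorem false_of_constant_outputs (hS : (fun _ => none : PartialAssignment ι) ∉ S) {q : S → ℝ}
    (h₀ : ∀ c, 0 ≤ q c) (h₁ : ∑ c, q c ≤ 1)
    (h : ∀ x, 1 - 1 / 3 ≤ ∑ c with c ∈ searchRel S x, q c) : False := by
  have hd : Disjoint (Finset.univ.filter fun c => c ∈ searchRel S fun _ => false)
      (Finset.univ.filter fun c => c ∈ searchRel S fun _ => !false) := by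
    rw [Finset.disjoint_filter]
    intro c _ hc hc'
    exact Set.disjoint_left.mp (disjoint_searchRel_not hS fun _ => false) hc hc'
  have h₂ := Finset.sum_le_sum_of_subset_of_nonneg
    (Finset.subset_univ (Finset.disjUnion _ _ hd)) fun c _ _ => h₀ c
  rw [Finset.sum_disjUnion] at h₂
  linarith [h fun _ => false, h fun _ => !false]

-- On the promise, the weight of every valid `c` is credited to the correct value `b`.
open Classical in
theorem le_sum_fcn {z : ι ⊕ S → Bool} (hz : z ∈ (fcn S).Dom) {ε : ℝ} {q : S → ℝ} (h₀ : ∀ c, 0 ≤ q c)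
    (h : ε ≤ ∑ c with c ∈ searchRel S (fun i => z (Sum.inl i)), q c) :
    ε ≤ ∑ b with b ∈ fcn S z, ∑ c, if z (Sum.inr c) = b then q c else 0 := by
  obtain ⟨b, hb⟩ := hz
  refine h.trans ?_
  calc ∑ c with c ∈ searchRel S (fun i => z (Sum.inl i)), q c ≤
        ∑ c, if z (Sum.inr c) = b then q c else 0 := by
        rw [Finset.sum_filter]
        refine Finset.sum_le_sum fun c _ => ?_
        by_cases hc : c ∈ searchRel S fun i => z (Sum.inl i)
        · rw [if_pos hc, if_pos (hb c hc)]
        · rw [if_neg hc]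
          split_ifs
          · exact h₀ c
          · exact le_rfl
    _ ≤ _ := Finset.single_le_sum (f := fun b => ∑ c, if z (Sum.inr c) = b then q c else 0)
        (fun b _ => Finset.sum_nonneg fun c _ => by split_ifs; exacts [h₀ c, le_rfl])
        (Finset.mem_filter.mpr ⟨Finset.mem_univ b, hb⟩)

/-- Each `c` is credited to exactly one value, so the total weight is preserved on all inputs, also
outside the promise. -/
theorem sum_bool_fcn (z : ι ⊕ S → Bool) (q : S → ℝ) :
    ∑ b, ∑ c, (if z (Sum.inr c) = b then q c else 0) = ∑ c, q c := by
  rw [Finset.sum_comm]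
  refine Finset.sum_congr rfl fun c _ => ?_
  simp

variable [Fintype ι]

theorem eval_toReal_literal {ι : Type} (i : ι) (b : Bool) (y : ι → Bool) :
    (if b then MvPolynomial.X i else 1 - MvPolynomial.X i : MvPolynomial ι ℝ).eval (toReal y) =
      if y i = b then 1 else 0 := by
  cases b <;> cases h : y i <;> simp [toReal, h]

theorem exists_adeg {A : Type} [Fintype A] [Nonempty A] (f : Relation ι A) :
    ∃ p : A → MvPolynomial ι ℝ, (∀ s, (p s).totalDegree ≤ adeg f) ∧ PolyComputes f (1 / 3) p := by
  classical
  refine Nat.sInf_mem (s := {d | ∃ p : A → MvPolynomial ι ℝ, (∀ s, (p s).totalDegree ≤ d) ∧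
    PolyComputes f (1 / 3) p}) ?_
  let F : (ι → Bool) → A := fun x => if h : x ∈ f.Dom then h.some else Classical.arbitrary A
  let p : A → MvPolynomial ι ℝ := fun a => ∑ x with F x = a,
    ∏ i, if x i then MvPolynomial.X i else 1 - MvPolynomial.X i
  have hp : ∀ a y, (p a).eval (toReal y) = if F y = a then 1 else 0 := by
    intro a y
    have : ∀ x : ι → Bool, (∏ i, if y i = x i then (1 : ℝ) else 0) = if y = x then 1 else 0 := by
      intro x
      rw [Finset.prod_ite_zero]
      simp [funext_iff]
    simp only [p, map_sum, map_prod, eval_toReal_literal, this, Finset.sum_ite_eq,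
      Finset.mem_filter, Finset.mem_univ, true_and]
  refine ⟨Finset.univ.sup fun a => (p a).totalDegree, p,
    fun s => Finset.le_sup (f := fun a => (p a).totalDegree) (Finset.mem_univ s), ?_, ?_, ?_⟩
  · intro s x
    rw [hp]
    split_ifs <;> norm_num
  · intro x
    simp [hp]
  · intro x hx
    have hF : F x ∈ f x := by
      simp only [F, dif_pos hx]
      exact hx.some_mem
    simp only [hp, Finset.sum_ite_eq, Finset.mem_filter, Finset.mem_univ, hF, and_self, if_true]
    norm_num

theorem adeg_fcn_le (htot : ∀ x, x ∈ (searchRel S).Dom) :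
    adeg (fcn S) ≤ adeg (searchRel S) + 1 := by
  classical
  have : Nonempty S := ⟨(htot fun _ => false).some⟩
  obtain ⟨p, hdeg, h₀, h₁, h⟩ := exists_adeg (searchRel S)
  -- `p c` times the indicator of `y c = b`, summed over `c`; the indicator is linear, so the degree
  -- grows by one.
  let p' : Bool → MvPolynomial (ι ⊕ S) ℝ := fun b => ∑ c, MvPolynomial.rename Sum.inl (p c) *
    if b then MvPolynomial.X (Sum.inr c) else 1 - MvPolynomial.X (Sum.inr c)
  have heval : ∀ b z, (p' b).eval (toReal z) = ∑ c, if z (Sum.inr c) = b then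
      (p c).eval (toReal fun i => z (Sum.inl i)) else 0 := by
    intro b z
    have hz : toReal z ∘ Sum.inl = toReal fun i => z (Sum.inl i) := rfl
    simp only [p', map_sum, map_mul, eval_toReal_literal, MvPolynomial.eval_rename, hz]
    simp only [mul_ite, mul_one, mul_zero]
  refine Nat.sInf_le ⟨p', fun b => ?_, ?_, ?_, ?_⟩
  · refine (MvPolynomial.totalDegree_finsetSum _ _).trans (Finset.sup_le fun c _ => ?_)
    refine (MvPolynomial.totalDegree_mul _ _).trans (add_le_add ?_ ?_)
    · exact (MvPolynomial.totalDegree_rename_le _ _).trans (hdeg c)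
    · cases b
      · refine (MvPolynomial.totalDegree_sub _ _).trans ?_
        simp
      · simp
  · intro b z
    rw [heval]
    exact Finset.sum_nonneg fun c _ => by split_ifs; exacts [h₀ _ _, le_rfl]
  · intro z
    simp only [heval]
    rw [sum_bool_fcn z fun c => (p c).eval (toReal fun i => z (Sum.inl i))]
    exact h₁ _
  · intro z hz
    simp only [heval]
    exact le_sum_fcn hz (fun c => h₀ c _) (h _ (htot _))

theorem one_le_adeg (htot : ∀ x, x ∈ (searchRel S).Dom)
    (hS : (fun _ => none : PartialAssignment ι) ∉ S) : 1 ≤ adeg (searchRel S) := by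
  have : Nonempty S := ⟨(htot fun _ => false).some⟩
  obtain ⟨p, hdeg, h₀, h₁, h⟩ := exists_adeg (searchRel S)
  by_contra! hlt
  have hconst : ∀ c x, (p c).eval (toReal x) = (p c).coeff 0 := by
    intro c x
    have hc := hdeg c
    rw [Nat.lt_one_iff.mp hlt, Nat.le_zero, MvPolynomial.totalDegree_eq_zero_iff_eq_C] at hc
    conv_lhs => rw [hc, MvPolynomial.eval_C]
  simp only [hconst] at h₀ h₁ h
  exact false_of_constant_outputs hS (fun c => h₀ c fun _ => false) (h₁ fun _ => false)
    fun x => h x (htot x)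

theorem exists_appdeg {A : Type} [Fintype A] [Nonempty A] (f : Relation ι A) :
    ∃ h : A → ConicalJunta ι, (∀ s, (h s).DegreeLE (appdeg f)) ∧ JuntaComputes f (1 / 3) h := by
  classical
  refine Nat.sInf_mem (s := {d | ∃ h : A → ConicalJunta ι, (∀ s, (h s).DegreeLE d) ∧
    JuntaComputes f (1 / 3) h}) ?_
  let F : (ι → Bool) → A := fun x => if h : x ∈ f.Dom then h.some else Classical.arbitrary A
  let h : A → ConicalJunta ι := fun a =>
    ⟨fun c => if ∃ x, (c = fun i => some (x i)) ∧ F x = a then 1 else 0,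
      fun c => by split_ifs <;> norm_num⟩
  have hh : ∀ a y, (h a).eval y = if F y = a then 1 else 0 := by
    intro a y
    rw [ConicalJunta.eval, Finset.sum_eq_single fun i => some (y i)]
    · have hy : PartialAssignment.Consistent (fun i => some (y i)) y :=
        fun i b hb => Option.some.inj hb
      rw [if_pos hy]
      have : (∃ x : ι → Bool, ((fun i => some (y i)) = fun i => some (x i)) ∧ F x = a) ↔
          F y = a := by
        constructor
        · rintro ⟨x, hx, rfl⟩
          congr 1
          funext i
          exact Option.some.inj (congrFun hx i)
        · intro hy
          exact ⟨y, rfl, hy⟩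
      simp only [h, this]
    · intro c _ hc
      split_ifs with hcy
      · simp only [h]
        rw [if_neg]
        rintro ⟨x, rfl, -⟩
        exact hc (funext fun i => congrArg some (hcy i (x i) rfl).symm)
      · rfl
    · simp
  refine ⟨Fintype.card ι, h, fun s c _ => Finset.card_le_univ _, ?_, ?_⟩
  · intro x
    simp [hh]
  · intro x hx
    have hF : F x ∈ f x := by
      simp only [F, dif_pos hx]
      exact hx.some_mem
    simp only [hh, Finset.sum_ite_eq, Finset.mem_filter, Finset.mem_univ, hF, and_self, if_true]
    norm_num

-- The instance in the definition of `eval` is traded for an arbitrary one, so that sums over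
-- assignments can be reindexed.
open Classical in
theorem ConicalJunta.eval_eq_sum [Fintype (PartialAssignment ι)] (h : ConicalJunta ι)
    (x : ι → Bool) : h.eval x = ∑ c, if c.Consistent x then h.coeff c else 0 := by
  rw [ConicalJunta.eval]
  congr!

theorem ConicalJunta.eval_nonneg (h : ConicalJunta ι) (x : ι → Bool) : 0 ≤ h.eval x :=
  Finset.sum_nonneg fun c _ => by split_ifs; exacts [h.nonneg c, le_rfl]

theorem appdeg_fcn_le (htot : ∀ x, x ∈ (searchRel S).Dom) :
    appdeg (fcn S) ≤ appdeg (searchRel S) + 1 := by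
  classical
  have : Nonempty S := ⟨(htot fun _ => false).some⟩
  obtain ⟨h, hdeg, h₁, h₂⟩ := exists_appdeg (searchRel S)
  let single : S → Bool → PartialAssignment S := fun c b c' => if c' = c then some b else none
  have hsingle : ∀ c b (y : S → Bool), (single c b).Consistent y ↔ y c = b := by
    intro c b y
    constructor
    · intro hy
      exact hy c b (by simp [single])
    · intro hy c' b' hb'
      by_cases hc : c' = c
      · subst hc
        simp only [single, if_true, Option.some.injEq] at hb'
        rw [hy, hb']
      · simp [single, hc] at hb'
  -- These are the coefficients of the sum over `c` of the junta `h c` times the literal `y c = b`: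
  -- a conjunction occurs only if its marked part is one such literal.
  let h' : Bool → ConicalJunta (ι ⊕ S) := fun b =>
    ⟨fun e => ∑ c, if (fun j => e (Sum.inr j)) = single c b then (h c).coeff fun i => e (Sum.inl i)
      else 0, fun e => Finset.sum_nonneg fun c _ => by split_ifs; exacts [(h c).nonneg _, le_rfl]⟩
  have heval : ∀ b z, (h' b).eval z = ∑ c, if z (Sum.inr c) = b then
      (h c).eval (fun i => z (Sum.inl i)) else 0 := by
    intro b z
    have hcons : ∀ (u : PartialAssignment ι) (v : PartialAssignment S),
        PartialAssignment.Consistent (Sum.elim u v) z ↔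
          u.Consistent (fun i => z (Sum.inl i)) ∧ v.Consistent fun j => z (Sum.inr j) := by
      intro u v
      constructor
      · exact fun H => ⟨fun i b hb => H (Sum.inl i) b hb, fun j b hb => H (Sum.inr j) b hb⟩
      · rintro ⟨H, H'⟩ (i | j) b hb
        · exact H i b hb
        · exact H' j b hb
    rw [ConicalJunta.eval_eq_sum, ← (Equiv.sumArrowEquivProdArrow ι S (Option Bool)).symm.sum_comp,
      Fintype.sum_prod_type]
    have hterm : ∀ (u : PartialAssignment ι) (v : PartialAssignment S),
        (if PartialAssignment.Consistent
            ((Equiv.sumArrowEquivProdArrow ι S (Option Bool)).symm (u, v)) z then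
          (h' b).coeff ((Equiv.sumArrowEquivProdArrow ι S (Option Bool)).symm (u, v)) else 0) =
        ∑ c, if v = single c b then (if z (Sum.inr c) = b then
          (if u.Consistent fun i => z (Sum.inl i) then (h c).coeff u else 0) else 0) else 0 := by
      intro u v
      have hsymm : (Equiv.sumArrowEquivProdArrow ι S (Option Bool)).symm (u, v) = Sum.elim u v := rfl
      have hcoeff : (h' b).coeff (Sum.elim u v) =
          ∑ c, if v = single c b then (h c).coeff u else 0 := rfl
      rw [hsymm, hcoeff, hcons]
      trans ∑ c, if (u.Consistent fun i => z (Sum.inl i)) ∧ v.Consistent fun j => z (Sum.inr j) then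
        (if v = single c b then (h c).coeff u else 0) else 0
      · split_ifs <;> simp
      refine Finset.sum_congr rfl fun c _ => ?_
      by_cases hv : v = single c b
      · subst hv
        rw [hsingle]
        by_cases hu : u.Consistent fun i => z (Sum.inl i) <;> by_cases hz : z (Sum.inr c) = b <;>
          simp [hu, hz]
      · simp [hv]
    simp only [hterm]
    calc _ = ∑ u : PartialAssignment ι, ∑ c, if z (Sum.inr c) = b then
          (if u.Consistent fun i => z (Sum.inl i) then (h c).coeff u else 0) else 0 := by
          refine Finset.sum_congr rfl fun u _ => ?_
          rw [Finset.sum_comm]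
          simp
      _ = _ := by
          rw [Finset.sum_comm]
          refine Finset.sum_congr rfl fun c _ => ?_
          by_cases hz : z (Sum.inr c) = b
          · simp [hz, ConicalJunta.eval]
          · simp [hz]
  refine Nat.sInf_le ⟨h', fun b e he => ?_, ?_, ?_⟩
  · obtain ⟨c, -, hc⟩ := Finset.exists_ne_zero_of_sum_ne_zero he
    rw [ite_ne_right_iff] at hc
    have hd := hdeg c _ hc.2
    have hs : e = Sum.elim (fun i => e (Sum.inl i)) (single c b) := by
      rw [← hc.1]
      funext j
      rcases j with i | j <;> rfl
    refine le_trans ?_ (Nat.add_le_add_right hd 1)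
    have hsub : (Finset.univ.filter fun j => (e j).isSome) ⊆
        ((Finset.univ.filter fun i => (e (Sum.inl i)).isSome).map Function.Embedding.inl) ∪
          {Sum.inr c} := by
      intro j hj
      rw [Finset.mem_filter] at hj
      rcases j with i | j
      · simp [hj.2]
      · have hj' := hj.2
        rw [hs] at hj'
        by_cases hjc : j = c
        · simp [hjc]
        · simp [single, hjc] at hj'
    exact (Finset.card_le_card hsub).trans ((Finset.card_union_le _ _).trans (by
      simp [PartialAssignment.size]))
  · intro z
    simp only [heval]
    rw [sum_bool_fcn z fun c => (h c).eval fun i => z (Sum.inl i)]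
    exact h₁ _
  · intro z hz
    simp only [heval]
    exact le_sum_fcn hz (fun c => (h c).eval_nonneg _) (h₂ _ (htot _))

theorem one_le_appdeg (htot : ∀ x, x ∈ (searchRel S).Dom)
    (hS : (fun _ => none : PartialAssignment ι) ∉ S) : 1 ≤ appdeg (searchRel S) := by
  classical
  have : Nonempty S := ⟨(htot fun _ => false).some⟩
  obtain ⟨h, hdeg, h₁, h₂⟩ := exists_appdeg (searchRel S)
  by_contra! hlt
  have hconst : ∀ c x, (h c).eval x = ∑ e, (h c).coeff e := by
    intro c x
    refine Finset.sum_congr rfl fun e _ => ?_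
    split_ifs with he
    · rfl
    · by_contra hne
      have hsize := hdeg c e (Ne.symm hne)
      rw [Nat.lt_one_iff.mp hlt, Nat.le_zero] at hsize
      refine he fun i b hb => ?_
      have := Finset.filter_eq_empty_iff.mp (Finset.card_eq_zero.mp hsize) (Finset.mem_univ i)
      simp [hb] at this
  simp only [hconst] at h₁ h₂
  exact false_of_constant_outputs hS (fun c => Finset.sum_nonneg fun e _ => (h c).nonneg e)
    (h₁ fun _ => false) fun x => h₂ x (htot x)

end Degree

/-! ### Adversary bounds -/

section Adversary

open Classical in
/-- The adversary bounds, with a general way `φ` of combining the weights of two inputs. -/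
noncomputable def gadv (φ : ℝ → ℝ → ℝ) {ι A : Type} [Fintype ι] (f : Relation ι A) : ℝ :=
  sInf {T : ℝ | ∃ m : (ι → Bool) → ι → ℝ,
    (∀ x ∈ f.Dom, ∀ i, 0 ≤ m x i) ∧
    (∀ x ∈ f.Dom, ∑ i, m x i ≤ T) ∧
    ∀ p ∈ f.Delta, 1 ≤ ∑ i with p.1 i ≠ p.2 i, φ (m p.1 i) (m p.2 i)}

/-- The properties of `min` and of the geometric mean that matter for the adversary bounds. -/
structure IsMean (φ : ℝ → ℝ → ℝ) : Prop where
  nonneg : ∀ {a b}, 0 ≤ a → 0 ≤ b → 0 ≤ φ a b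
  add_le : ∀ {a b c d}, 0 ≤ a → 0 ≤ b → 0 ≤ c → 0 ≤ d → φ a c + φ b d ≤ φ (a + b) (c + d)
  one : 1 ≤ φ 1 1

theorem isMean_min : IsMean fun a b => min a b where
  nonneg := fun ha hb => le_min ha hb
  add_le := fun _ _ _ _ => le_min (add_le_add (min_le_left _ _) (min_le_left _ _))
    (add_le_add (min_le_right _ _) (min_le_right _ _))
  one := by simp

theorem isMean_sqrt : IsMean fun a b => Real.sqrt (a * b) where
  nonneg := fun _ _ => Real.sqrt_nonneg _
  add_le := by
    intro a b c d ha hb hc hd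
    apply Real.le_sqrt_of_sq_le
    have h₁ := Real.sq_sqrt (mul_nonneg ha hc)
    have h₂ := Real.sq_sqrt (mul_nonneg hb hd)
    -- The arithmetic-geometric mean inequality for `a * d` and `b * c`.
    have h₃ : 2 * (Real.sqrt (a * c) * Real.sqrt (b * d)) ≤ a * d + b * c := by
      rw [← Real.sqrt_mul (mul_nonneg ha hc), show a * c * (b * d) = (a * d) * (b * c) by ring,
        Real.sqrt_mul (mul_nonneg ha hd)]
      have h₄ := Real.sq_sqrt (mul_nonneg ha hd)
      have h₅ := Real.sq_sqrt (mul_nonneg hb hc)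
      nlinarith [sq_nonneg (Real.sqrt (a * d) - Real.sqrt (b * c))]
    nlinarith
  one := by simp

namespace IsMean

variable {φ : ℝ → ℝ → ℝ}

theorem sum_le (hφ : IsMean φ) {α : Type} (s : Finset α) {a b : α → ℝ} (ha : ∀ i, 0 ≤ a i)
    (hb : ∀ i, 0 ≤ b i) : ∑ i ∈ s, φ (a i) (b i) ≤ φ (∑ i ∈ s, a i) (∑ i ∈ s, b i) := by
  classical
  induction s using Finset.induction_on with
  | empty => simpa using hφ.nonneg le_rfl le_rfl
  | insert i s hi ih =>
    rw [Finset.sum_insert hi, Finset.sum_insert hi, Finset.sum_insert hi]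
    exact (add_le_add le_rfl ih).trans (hφ.add_le (ha i) (Finset.sum_nonneg fun j _ => ha j) (hb i)
      (Finset.sum_nonneg fun j _ => hb j))

variable {ι A : Type} [Fintype ι] {S : Finset (PartialAssignment ι)}

/-- A bound valid for every feasible `T` passes to the infimum without its being attained;
feasibility comes from constant weights `1`. -/
theorem exists_le_gadv (hφ : IsMean φ) (f : Relation ι A) {C B : ℝ} (hC : 0 ≤ C)
    (h : ∀ T, ∀ m : (ι → Bool) → ι → ℝ, (∀ x ∈ f.Dom, ∀ i, 0 ≤ m x i) →
      (∀ x ∈ f.Dom, ∑ i, m x i ≤ T) →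
      (∀ p ∈ f.Delta, 1 ≤ ∑ i with p.1 i ≠ p.2 i, φ (m p.1 i) (m p.2 i)) → B ≤ C * T) :
    B ≤ C * gadv φ f := by
  rw [gadv, ← smul_eq_mul, ← Real.sInf_smul_of_nonneg hC]
  refine le_csInf ?_ ?_
  · refine Set.Nonempty.smul_set ⟨Fintype.card ι, fun _ _ => 1, fun _ _ _ => zero_le_one,
      fun _ _ => by simp, ?_⟩
    rintro ⟨x, x'⟩ ⟨hx, hx', hd⟩
    have hne : x ≠ x' := by
      rintro rfl
      rw [Set.inter_self] at hd
      exact hx.ne_empty hd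
    obtain ⟨i, hi⟩ := Function.ne_iff.mp hne
    refine hφ.one.trans (Finset.single_le_sum (f := fun _ => φ 1 1)
      (fun _ _ => hφ.nonneg zero_le_one zero_le_one) (Finset.mem_filter.mpr ⟨Finset.mem_univ i, hi⟩))
  · rintro _ ⟨T, ⟨m, h₀, h₁, h₂⟩, rfl⟩
    refine h T m h₀ h₁ fun p hp => ?_
    convert h₂ p hp

theorem gadv_le (φ : ℝ → ℝ → ℝ) {f : Relation ι A} (hf : f.Dom.Nonempty) {T : ℝ}
    (m : (ι → Bool) → ι → ℝ) (h₀ : ∀ x ∈ f.Dom, ∀ i, 0 ≤ m x i) (h₁ : ∀ x ∈ f.Dom, ∑ i, m x i ≤ T)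
    (h₂ : ∀ p ∈ f.Delta, 1 ≤ ∑ i with p.1 i ≠ p.2 i, φ (m p.1 i) (m p.2 i)) : gadv φ f ≤ T := by
  refine csInf_le ⟨0, ?_⟩ ⟨m, h₀, h₁, fun p hp => ?_⟩
  · rintro T ⟨m, h₀, h₁, -⟩
    obtain ⟨x, hx⟩ := hf
    exact (Finset.sum_nonneg fun i _ => h₀ x hx i).trans (h₁ x hx)
  · convert h₂ p hp

theorem gadv_nonneg (φ : ℝ → ℝ → ℝ) {f : Relation ι A} (hf : f.Dom.Nonempty) : 0 ≤ gadv φ f := by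
  refine Real.sInf_nonneg ?_
  rintro T ⟨m, h₀, h₁, -⟩
  obtain ⟨x, hx⟩ := hf
  exact (Finset.sum_nonneg fun i _ => h₀ x hx i).trans (h₁ x hx)

open Classical in
/-- The weight of the marked bits is moved to the positions of the certificates. -/
noncomputable def moveWeight (w : ι ⊕ S → ℝ) (i : ι) : ℝ :=
  w (Sum.inl i) + ∑ c : S, if (c.1 i).isSome then w (Sum.inr c) else 0

theorem moveWeight_nonneg {ι : Type} {S : Finset (PartialAssignment ι)}
    {w : ι ⊕ S → ℝ} (hw : ∀ j, 0 ≤ w j) (i : ι) : 0 ≤ moveWeight w i :=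
  add_nonneg (hw _) (Finset.sum_nonneg fun c _ => by split_ifs; exacts [hw _, le_rfl])

/-- The weight of `y c` is copied to each position of `c`, at most `cert S` times. -/
theorem sum_moveWeight_le (hcert : 1 ≤ cert S) {w : ι ⊕ S → ℝ} (hw : ∀ j, 0 ≤ w j) :
    ∑ i, moveWeight w i ≤ cert S * ∑ j, w j := by
  have hcert' : (1 : ℝ) ≤ cert S := by exact_mod_cast hcert
  simp only [moveWeight]
  rw [Finset.sum_add_distrib, Fintype.sum_sum_type, mul_add]
  refine add_le_add ?_ ?_
  · exact le_mul_of_one_le_left (Finset.sum_nonneg fun i _ => hw _) hcert'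
  · rw [Finset.sum_comm, Finset.mul_sum]
    refine Finset.sum_le_sum fun c _ => ?_
    rw [← Finset.sum_filter, Finset.sum_const, nsmul_eq_mul]
    refine mul_le_mul_of_nonneg_right ?_ (hw _)
    exact_mod_cast size_le_cert c.2

/-- A marked bit where the inputs differ belongs to some `c` valid for `x`, hence violated by `x'`;
its term is charged to a position of `c` where `x` and `x'` differ. Superadditivity then merges the
terms at each position. -/
theorem sum_le_sum_moveWeight (hφ : IsMean φ) {x x' : ι → Bool}
    (hd : searchRel S x ∩ searchRel S x' = ∅) {w w' : ι ⊕ S → ℝ} (hw : ∀ j, 0 ≤ w j)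
    (hw' : ∀ j, 0 ≤ w' j) :
    ∑ j with markInput S x true j ≠ markInput S x' false j, φ (w j) (w' j) ≤
      ∑ i with x i ≠ x' i, φ (moveWeight w i) (moveWeight w' i) := by
  classical
  have hnn : ∀ j, 0 ≤ φ (w j) (w' j) := fun j => hφ.nonneg (hw j) (hw' j)
  have hdiff : ∀ c ∈ searchRel S x, ∃ i, (c.1 i).isSome ∧ x i ≠ x' i := by
    intro c hc
    have hc' : ¬c.1.Consistent x' := fun hc' => (Set.mem_empty_iff_false c).mp (hd ▸ ⟨hc, hc'⟩)
    simp only [PartialAssignment.Consistent, not_forall] at hc'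
    obtain ⟨i, b, hb, hne⟩ := hc'
    refine ⟨i, by simp [hb], ?_⟩
    rw [hc i b hb]
    exact Ne.symm hne
  calc ∑ j with markInput S x true j ≠ markInput S x' false j, φ (w j) (w' j) ≤
        (∑ i with x i ≠ x' i, φ (w (Sum.inl i)) (w' (Sum.inl i))) +
          ∑ c with c ∈ searchRel S x, φ (w (Sum.inr c)) (w' (Sum.inr c)) := by
        rw [Finset.sum_filter, Fintype.sum_sum_type, Finset.sum_filter, Finset.sum_filter]
        refine add_le_add (Finset.sum_le_sum fun i _ => le_rfl) (Finset.sum_le_sum fun c _ => ?_)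
        by_cases hc : c ∈ searchRel S x
        · rw [if_pos hc]
          split_ifs
          exacts [le_rfl, hnn _]
        · rw [markInput_inr_of_notMem _ hc, markInput_false]
          simp [hc]
    _ ≤ (∑ i with x i ≠ x' i, φ (w (Sum.inl i)) (w' (Sum.inl i))) +
          ∑ i with x i ≠ x' i, ∑ c : S,
            if (c.1 i).isSome then φ (w (Sum.inr c)) (w' (Sum.inr c)) else 0 := by
        refine add_le_add le_rfl ?_
        rw [Finset.sum_comm, Finset.sum_filter]
        refine Finset.sum_le_sum fun c _ => ?_
        have hnn' : ∀ i ∈ Finset.univ.filter fun i => x i ≠ x' i,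
            0 ≤ if (c.1 i).isSome then φ (w (Sum.inr c)) (w' (Sum.inr c)) else 0 := by
          intro i _
          split_ifs
          exacts [hnn _, le_rfl]
        split_ifs with hc
        · obtain ⟨i, hi, hne⟩ := hdiff c hc
          refine le_trans ?_ (Finset.single_le_sum hnn'
            (Finset.mem_filter.mpr ⟨Finset.mem_univ i, hne⟩))
          rw [if_pos hi]
        · exact Finset.sum_nonneg hnn'
    _ ≤ _ := by
        rw [← Finset.sum_add_distrib]
        refine Finset.sum_le_sum fun i _ => ?_
        refine le_trans (add_le_add le_rfl ?_) (hφ.add_le (hw _)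
          (Finset.sum_nonneg fun c _ => by split_ifs; exacts [hw _, le_rfl]) (hw' _)
          (Finset.sum_nonneg fun c _ => by split_ifs; exacts [hw' _, le_rfl]))
        refine le_trans (Finset.sum_le_sum fun c _ => ?_) (hφ.sum_le Finset.univ
          (fun c => by split_ifs; exacts [hw _, le_rfl])
          (fun c => by split_ifs; exacts [hw' _, le_rfl]))
        split_ifs
        exacts [le_rfl, hφ.nonneg le_rfl le_rfl]

/-- One weight function must serve `x` in both roles, with valid outputs marked `1` or `0`. The
moved weights of both inputs are therefore added, which gives the factor `2`. -/
theorem gadv_searchRel_le (hφ : IsMean φ) (htot : ∀ x, x ∈ (searchRel S).Dom)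
    (hcert : 1 ≤ cert S) :
    gadv φ (searchRel S) ≤ 2 * cert S * gadv φ (fcn S) := by
  refine hφ.exists_le_gadv (fcn S) (by positivity) fun T m h₀ h₁ h₂ => ?_
  have hw : ∀ x b j, 0 ≤ m (markInput S x b) j := fun x b j => h₀ _ (markInput_mem_dom (htot x) b) j
  have hcross : ∀ x x', searchRel S x ∩ searchRel S x' = ∅ →
      1 ≤ ∑ i with x i ≠ x' i, φ (moveWeight (m (markInput S x true)) i)
        (moveWeight (m (markInput S x' false)) i) := by
    intro x x' hd
    refine le_trans (h₂ (markInput S x true, markInput S x' false)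
      ⟨markInput_mem_dom (htot x) _, markInput_mem_dom (htot x') _, ?_⟩)
      (sum_le_sum_moveWeight hφ hd (hw _ _) (hw _ _))
    rw [fcn_markInput (htot x), fcn_markInput (htot x')]
    simp
  refine gadv_le φ ⟨_, htot fun _ => false⟩
    (fun x i => moveWeight (m (markInput S x true)) i + moveWeight (m (markInput S x false)) i)
    ?_ ?_ ?_
  · exact fun x _ i => add_nonneg (moveWeight_nonneg (hw _ _) i) (moveWeight_nonneg (hw _ _) i)
  · intro x hx
    have hle : ∀ b, ∑ i, moveWeight (m (markInput S x b)) i ≤ cert S * T := fun b =>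
      (sum_moveWeight_le hcert (hw x b)).trans
        (mul_le_mul_of_nonneg_left (h₁ _ (markInput_mem_dom hx b)) (Nat.cast_nonneg _))
    rw [Finset.sum_add_distrib]
    linarith [hle true, hle false]
  · rintro ⟨x, x'⟩ ⟨-, -, hd⟩
    refine (hcross x x' hd).trans (Finset.sum_le_sum fun i _ => ?_)
    have hn : ∀ x b, 0 ≤ moveWeight (m (markInput S x b)) i :=
      fun x b => moveWeight_nonneg (hw x b) i
    -- Opposite markings are paired; the second pair contributes a non-negative term that is
    -- dropped.
    have := hφ.add_le (hn x true) (hn x false) (hn x' false) (hn x' true)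
    rw [add_comm (moveWeight (m (markInput S x' true)) i)]
    linarith [hφ.nonneg (hn x false) (hn x' true)]

end IsMean

theorem adv_eq_gadv {ι A : Type} [Fintype ι] (f : Relation ι A) :
    adv f = gadv (fun a b => Real.sqrt (a * b)) f := by
  unfold adv gadv
  congr!

theorem cadv_eq_gadv {ι A : Type} [Fintype ι] (f : Relation ι A) :
    cadv f = gadv (fun a b => min a b) f := by
  unfold cadv gadv
  congr!

end Adversary

/-! ### The theorem -/

theorem isBigO_of_eventually_le {α : Type} {l : Filter α} {f g : α → ℝ} (C : ℝ)
    (hf : ∀ i, 0 ≤ f i) (h : ∀ᶠ i in l, f i ≤ C * g i) (hg : ∀ i, 0 ≤ g i) : f =O[l] g :=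
  IsBigO.of_bound C (h.mono fun i hi => by
    rwa [Real.norm_of_nonneg (hf i), Real.norm_of_nonneg (hg i)])

theorem softO_of_isBigO {n : ℕ → ℕ} {f g : ℕ → ℝ} (h : f =O[atTop] g) : SoftO n f g :=
  ⟨0, by simpa using h⟩

theorem softO_of_le_cert (F : TFNP) {f g : ℕ → ℝ} (C : ℝ) (hf : ∀ i, 0 ≤ f i) (hg : ∀ i, 0 ≤ g i)
    (h : ∀ᶠ i in atTop, f i ≤ C * (g i * cert (F.S i))) : SoftO F.n f g := by
  obtain ⟨k, hk⟩ := F.cert_polylog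
  exact ⟨k, (isBigO_of_eventually_le C hf h fun i => mul_nonneg (hg i) (Nat.cast_nonneg _)).trans
    ((isBigO_refl g _).mul hk)⟩

theorem isBigO_of_le_add_one {f g : ℕ → ℕ} (h : ∀ i, f i ≤ g i + 1) (hg : ∀ᶠ i in atTop, 1 ≤ g i) :
    (fun i => (f i : ℝ)) =O[atTop] fun i => (g i : ℝ) := by
  refine isBigO_of_eventually_le 2 (fun i => Nat.cast_nonneg _) (hg.mono fun i hi => ?_)
    fun i => Nat.cast_nonneg _
  have := h i
  exact_mod_cast (by omega : f i ≤ 2 * g i)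

theorem rpow_one_third_le {a b : ℝ} (ha : 0 ≤ a) (hb : 0 ≤ b) (h : a ≤ b ^ 3) :
    a ^ (1 / 3 : ℝ) ≤ b := by
  refine (Real.rpow_le_rpow ha h (by norm_num)).trans_eq ?_
  rw [← Real.rpow_natCast, ← Real.rpow_mul hb]
  norm_num

end Query

open Query in
theorem mainTheorem4 (F : Query.TFNP)
    (hF : ∀ᶠ i in atTop, (fun _ => none : Query.PartialAssignment (Fin (F.n i))) ∉ F.S i) :
    Query.SoftTheta F.n (fun i => (Query.detQuery (Query.fcn (F.S i)) : ℝ))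
      (fun i => (Query.detQuery (Query.searchRel (F.S i)) : ℝ)) ∧
    Query.SoftTheta F.n (fun i => (Query.randQuery (Query.fcn (F.S i)) : ℝ))
      (fun i => (Query.randQuery (Query.searchRel (F.S i)) : ℝ)) ∧
    ((fun i => (Query.quantumQuery (Query.fcn (F.S i)) : ℝ)) =O[atTop]
      (fun i => (Query.quantumQuery (Query.searchRel (F.S i)) : ℝ)) ∧
    Query.SoftOmega F.n (fun i => (Query.quantumQuery (Query.fcn (F.S i)) : ℝ))
      (fun i => (Query.quantumQuery (Query.searchRel (F.S i)) : ℝ) ^ (1 / 3 : ℝ))) ∧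
    ((fun i => (Query.adeg (Query.fcn (F.S i)) : ℝ)) =O[atTop]
      (fun i => (Query.adeg (Query.searchRel (F.S i)) : ℝ)) ∧
    (fun i => (Query.appdeg (Query.fcn (F.S i)) : ℝ)) =O[atTop]
      (fun i => (Query.appdeg (Query.searchRel (F.S i)) : ℝ))) ∧
    (Query.SoftOmega F.n (fun i => Query.cadv (Query.fcn (F.S i)))
      (fun i => Query.cadv (Query.searchRel (F.S i))) ∧
    Query.SoftOmega F.n (fun i => Query.adv (Query.fcn (F.S i)))
      (fun i => Query.adv (Query.searchRel (F.S i)))) := by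
  have hcert : ∀ᶠ i in atTop, 1 ≤ cert (F.S i) := hF.mono fun i => one_le_cert (F.total i)
  have hdom : ∀ i, (fcn (F.S i)).Dom.Nonempty :=
    fun i => ⟨_, markInput_mem_dom (F.total i fun _ => false) false⟩
  have hdom' : ∀ i, (searchRel (F.S i)).Dom.Nonempty := fun i => ⟨_, F.total i fun _ => false⟩
  refine ⟨⟨softO_of_isBigO ?_, ?_⟩, ⟨softO_of_isBigO ?_, ?_⟩, ⟨?_, ?_⟩, ⟨?_, ?_⟩, ?_, ?_⟩
  · exact isBigO_of_le_add_one (fun i => detQuery_fcn_le (F.total i))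
      (hF.mono fun i => one_le_detQuery (F.total i))
  · refine softO_of_le_cert F 1 (fun i => Nat.cast_nonneg _) (fun i => Nat.cast_nonneg _)
      (hcert.mono fun i hi => ?_)
    have := detQuery_searchRel_le (F.total i) hi
    rw [one_mul, mul_comm]
    exact_mod_cast this
  · exact isBigO_of_le_add_one (fun i => randQuery_fcn_le (F.total i))
      (hF.mono fun i => one_le_randQuery (F.total i))
  · refine softO_of_le_cert F 3 (fun i => Nat.cast_nonneg _) (fun i => Nat.cast_nonneg _)
      (hcert.mono fun i hi => ?_)
    have := randQuery_searchRel_le (F.total i) hi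
    rw [mul_comm (randQuery _ : ℝ)]
    exact_mod_cast this
  · exact isBigO_of_le_add_one (fun i => quantumQuery_fcn_le (F.total i))
      (hF.mono fun i => one_le_quantumQuery (F.total i))
  · refine softO_of_le_cert F 400 (fun i => by positivity) (fun i => Nat.cast_nonneg _)
      (hcert.mono fun i hi => rpow_one_third_le (Nat.cast_nonneg _) (by positivity) ?_)
    have h := quantumQuery_searchRel_le (F.total i) hi
    -- Cubing all factors is wasteful but harmless: after the cube root only `cert`, a
    -- polylogarithmic factor, remains beside the constant.
    have h' : 400 * quantumQuery (fcn (F.S i)) ^ 3 * cert (F.S i) ≤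
        (400 * (quantumQuery (fcn (F.S i)) * cert (F.S i))) ^ 3 := by
      rw [mul_pow, mul_pow, mul_assoc]
      exact Nat.mul_le_mul (by norm_num)
        (Nat.mul_le_mul_left _ (Nat.le_self_pow (by norm_num) _))
    exact_mod_cast h.trans h'
  · exact isBigO_of_le_add_one (fun i => adeg_fcn_le (F.total i))
      (hF.mono fun i => one_le_adeg (F.total i))
  · exact isBigO_of_le_add_one (fun i => appdeg_fcn_le (F.total i))
      (hF.mono fun i => one_le_appdeg (F.total i))
  · simp only [cadv_eq_gadv]
    refine softO_of_le_cert F 2 (fun i => IsMean.gadv_nonneg _ (hdom' i))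
      (fun i => IsMean.gadv_nonneg _ (hdom i)) (hcert.mono fun i hi => ?_)
    exact (isMean_min.gadv_searchRel_le (F.total i) hi).trans_eq (by ring)
  · simp only [adv_eq_gadv]
    refine softO_of_le_cert F 2 (fun i => IsMean.gadv_nonneg _ (hdom' i))
      (fun i => IsMean.gadv_nonneg _ (hdom i)) (hcert.mono fun i hi => ?_)
    exact (isMean_sqrt.gadv_searchRel_le (F.total i) hi).trans_eq (by ring)
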